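/- **Setting.** Let $\Sigma\subset\mathbb R^3$ be a compact set (the detector surface), and let $\varepsilon>0$, $f\in C_c(\mathbb R^3)$, $\alpha_1\in C^2(\mathbb R^3)$, $\rho_1\in C^1(\mathbb R^3)$ be such that $\Sigma$ encloses $\operatorname{supp} f$, i.e. every point of $\operatorname{supp} f$ lies in a bounded connected component of $\mathbb R^3\setminus\Sigma$, and $$\operatorname{supp}\alpha_1\cup\operatorname{supp}\rho_1\subsetneq\operatorname{int}(\operatorname{supp} f).$$ With $\mathscr E_t(x,y)=\{z\in\mathbb R^3: |z-x|+|z-y|\le t\}$ define, for $|y-x|\le t$, $$\begin{aligned}K(t,x,y;\varepsilon)={}&\frac{(t-|y-x|)^2}{8\pi|y-x|}(1-\varepsilon\alpha_1(y))+\int_{\mathscr E_t(x,y)}\frac{\varepsilon\alpha_1(z)}{16\pi^2|z-x||z-y|}\,dz\\&+\int_{\mathscr E_t(x,y)}\frac{t-|z-x|-|z-y|}{16\pi^2|z-x||z-y|}\,\varepsilon\nabla\rho_1(z)\cdot\frac{z-y}{|z-y|}\,dz\\&+\int_{\mathscr E_t(x,y)}\frac{(t-|z-x|-|z-y|)^2}{32\pi^2|z-x||z-y|^2}\,\varepsilon\nabla\rho_1(z)\cdot\frac{z-y}{|z-y|}\,dz,\end{aligned}$$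 and $K(t,x,y;\varepsilon)=0$ for $|y-x|>t$. Let $\mathcal R_3[g](r,\theta)=\int_{\{y\cdot\theta=r\}}g\,ds$ ($r\ge0$, $\theta\in S^2$) be the Radon transform, with inverse $\mathcal R_3^{-1}$ on the image of the continuous compactly supported functions, and let $X_3[\varphi](y,v)=\int_{\mathbb R}\varphi(y+sv)\,ds$ ($y\in\mathbb R^3$, $v\in S^2$) be the X-ray transform. The measurements are $M_{r,\theta}(t,x)=\mathcal R_3[K(t,x,\cdot\,;\varepsilon)f](r,\theta)$, and for $x\in\Sigma$, $y\in\mathbb R^3$ put $$\begin{aligned}M_{0,x}(y)&=\lim_{t\downarrow|y-x|}\partial_t\mathcal R_3^{-1}[M_{r,\theta}(t,x)](y),\\ M_{\infty,x}(y)&=\lim_{t\to\infty}\partial_{tt}\mathcal R_3^{-1}[M_{r,\theta}(t,x)](y),\\ N_{\infty,x}(y)&=\lim_{t\to\infty}\bigl(M_{\infty,x}(y)\,t-\partial_t\mathcal R_3^{-1}[M_{r,\theta}(t,x)](y)\bigr).\end{aligned}$$ **Proposition.** These derivatives (for $t>|y-x|$ near $|y-x|$, respectively for large $t$) and limits exist,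 and the data $M_{0,x}(y)$, $N_{\infty,x}(y)$ ($x\in\Sigma$, $y\in\mathbb R^3$) determine the X-ray transform $X_3[\varepsilon\alpha_1](y,v)$ for all $y\in\mathbb R^3$, $v\in S^2$: if two tuples $(\varepsilon,f,\alpha_1,\rho_1)$ satisfying the assumptions with the same $\Sigma$ have the same data, then they have the same $X_3[\varepsilon\alpha_1]$. Moreover it is given by an explicit formula as follows. For $y_0\in\mathbb R^3$ and $v\in S^2$ call $(x,x')$ a detector pair for $(y_0,v)$ if $x=y_0-av\in\Sigma$, $x'=y_0+bv\in\Sigma$ with $a,b\ge0$, and the segment $[x,x']$ contains $\operatorname{supp} f\cap(y_0+\mathbb Rv)$. 1. A detector pair exists for every $y_0\in\operatorname{supp} f$ and $v\in S^2$. 2. If $y_0$ lies on the line $y+\mathbb Rv$, $y_0\notin\operatorname{supp}\alpha_1\cup\operatorname{supp}\rho_1$, $f(y_0)\ne0$, and $(x,x')$ is a detector pair for $(y_0,v)$, then $$f(y_0)=4\pi N_{\infty,x}(y_0),\qquad X_3[\varepsilon\alpha_1](y,v)=8\pi\,\frac{M_{0,x}(y_0)|y_0-x|+M_{0,x'}(y_0)|y_0-x'|}{f(y_0)}.$$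 3. If the line $y+\mathbb Rv$ misses $\operatorname{supp} f$, then $X_3[\varepsilon\alpha_1](y,v)=0$. If it meets $\operatorname{supp} f$, then for every $\delta>0$ there are a point $y_0$ at distance less than $\delta$ from some point of the line, with $y_0\notin\operatorname{supp}\alpha_1\cup\operatorname{supp}\rho_1$ and $f(y_0)\neq0$, and a detector pair $(x,x')$ for $(y_0,v)$ such that $$\left|X_3[\varepsilon\alpha_1](y,v)-8\pi\,\frac{M_{0,x}(y_0)|y_0-x|+M_{0,x'}(y_0)|y_0-x'|}{4\pi N_{\infty,x}(y_0)}\right|<\delta.$$ -/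

import Mathlib

open MeasureTheory Filter Topology

noncomputable section

/-- Euclidean three-space. -/
abbrev R3 : Type := EuclideanSpace ℝ (Fin 3)

/-- The closed solid prolate spheroid with foci `x` and `y` and larger semi-axis `t / 2`. -/
def spheroid (t : ℝ) (x y : R3) : Set R3 := {z | ‖z - x‖ + ‖z - y‖ ≤ t}

/-- The three-dimensional Radon transform: the integral of `g` over the plane
`{y | y · θ = r}` (for a unit vector `θ`) with respect to surface measure. The plane is
parametrised isometrically by the orthogonal complement of `θ`, with its Lebesgue measure. -/
def radon (g : R3 → ℝ) (r : ℝ) (θ : R3) : ℝ :=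
  ∫ w : (Submodule.span ℝ {θ}).orthogonal, g (r • θ + (w : R3))

/-- `h` is the Radon transform of `g` for all planes, `r ≥ 0` and `θ` in the unit sphere. -/
def IsRadonTransformOf (h : ℝ → R3 → ℝ) (g : R3 → ℝ) : Prop :=
  ∀ (r : ℝ) (θ : R3), 0 ≤ r → ‖θ‖ = 1 → h r θ = radon g r θ

open Classical in
/-- The inverse Radon transform, as the inverse of the Radon transform acting on continuous
compactly supported functions (zero outside the range of that operator). -/
def radonInv (h : ℝ → R3 → ℝ) : R3 → ℝ :=
  if H : ∃ g : R3 → ℝ, Continuous g ∧ HasCompactSupport g ∧ IsRadonTransformOf h g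
  then H.choose else 0

/-- The three-dimensional X-ray transform: the integral of `φ` over the line through `y` with
direction `v` (a unit vector). -/
def xray (φ : R3 → ℝ) (y v : R3) : ℝ := ∫ s : ℝ, φ (y + s • v)

/-- The unknowns: the source `f`, the perturbation `α₁` of the squared sound speed, the
perturbation `ρ₁` of the mass density, and the size `ε` of the perturbations. -/
structure Specimen where
  f : R3 → ℝ
  α₁ : R3 → ℝ
  ρ₁ : R3 → ℝ
  ε : ℝ

namespace Specimen

/-- The first-order kernel `K(t, x, y; ε)`, which vanishes for `|y - x| > t`. -/
def kernel (S : Specimen) (t : ℝ) (x y : R3) : ℝ :=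
  if ‖y - x‖ ≤ t then
    (t - ‖y - x‖) ^ 2 / (8 * Real.pi * ‖y - x‖) * (1 - S.ε * S.α₁ y)
    + (∫ z in spheroid t x y,
        1 / (16 * Real.pi ^ 2 * ‖z - x‖ * ‖z - y‖) * (S.ε * S.α₁ z))
    + (∫ z in spheroid t x y,
        (t - ‖z - x‖ - ‖z - y‖) / (16 * Real.pi ^ 2 * ‖z - x‖ * ‖z - y‖)
          * (S.ε * inner ℝ (gradient S.ρ₁ z) (‖z - y‖⁻¹ • (z - y))))
    + (∫ z in spheroid t x y,
        (t - ‖z - x‖ - ‖z - y‖) ^ 2 / (32 * Real.pi ^ 2 * ‖z - x‖ * ‖z - y‖ ^ 2)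
          * (S.ε * inner ℝ (gradient S.ρ₁ z) (‖z - y‖⁻¹ • (z - y))))
  else 0

/-- The measurement `M_{r,θ}(t, x)` at the detector point `x` and the time `t`, for
illumination of the plane `{y | y · θ = r}`. -/
def measurement (S : Specimen) (r : ℝ) (θ : R3) (t : ℝ) (x : R3) : ℝ :=
  radon (fun y => S.kernel t x y * S.f y) r θ

/-- The inverse Radon transform (in `(r, θ)`) of the measurements at time `t` and detector
point `x`, evaluated at `y`. -/
def inverted (S : Specimen) (x y : R3) (t : ℝ) : ℝ :=
  radonInv (fun r θ => S.measurement r θ t x) y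

/-- `M_{0,x}(y)`, the limit of `∂ₜ R₃⁻¹[M_{r,θ}(t,x)](y)` as `t ↓ |y - x|`. -/
def M0 (S : Specimen) (x y : R3) : ℝ :=
  limUnder (𝓝[>] ‖y - x‖) (fun t => deriv (S.inverted x y) t)

/-- `M_{∞,x}(y)`, the limit of `∂ₜₜ R₃⁻¹[M_{r,θ}(t,x)](y)` as `t → ∞`. -/
def Minf (S : Specimen) (x y : R3) : ℝ :=
  limUnder atTop (fun t => deriv (deriv (S.inverted x y)) t)

/-- `N_{∞,x}(y)`, the limit of `M_{∞,x}(y) t - ∂ₜ R₃⁻¹[M_{r,θ}(t,x)](y)` as `t → ∞`. -/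
def Ninf (S : Specimen) (x y : R3) : ℝ :=
  limUnder atTop (fun t => S.Minf x y * t - deriv (S.inverted x y) t)

/-- The data `M_{0,x}(y)` and `N_{∞,x}(y)` are well defined: the derivatives and the limits
in their definitions exist. -/
def DataExist (S : Specimen) (x y : R3) : Prop :=
  (∀ᶠ t in 𝓝[>] ‖y - x‖, DifferentiableAt ℝ (S.inverted x y) t) ∧
  Tendsto (fun t => deriv (S.inverted x y) t) (𝓝[>] ‖y - x‖) (𝓝 (S.M0 x y)) ∧
  (∀ᶠ t in atTop, ContDiffAt ℝ 2 (S.inverted x y) t) ∧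
  Tendsto (fun t => deriv (deriv (S.inverted x y)) t) atTop (𝓝 (S.Minf x y)) ∧
  Tendsto (fun t => S.Minf x y * t - deriv (S.inverted x y) t) atTop (𝓝 (S.Ninf x y))

/-- The union of the supports of the two perturbations. -/
def perturbed (S : Specimen) : Set R3 := tsupport S.α₁ ∪ tsupport S.ρ₁

end Specimen

/-- The set `D` encloses `A`: every point of `A` lies in a bounded connected component of the
complement of `D`. -/
def Encloses (D A : Set R3) : Prop :=
  ∀ p ∈ A, p ∉ D ∧ Bornology.IsBounded (connectedComponentIn Dᶜ p)

/-- The standing assumptions on the unknowns, for detectors placed on `D`. -/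
structure Specimen.Admissible (D : Set R3) (S : Specimen) : Prop where
  ε_pos : 0 < S.ε
  continuous_f : Continuous S.f
  hasCompactSupport_f : HasCompactSupport S.f
  contDiff_α₁ : ContDiff ℝ 2 S.α₁
  contDiff_ρ₁ : ContDiff ℝ 1 S.ρ₁
  encloses : Encloses D (tsupport S.f)
  perturbed_ssubset : S.perturbed ⊂ interior (tsupport S.f)

/-- `x` and `x'` are detector points on the line through `y` with direction `v`, on either side
of `y`, and the segment from `x` to `x'` contains all of the part of `supp f` on that line. -/
def IsDetectorPair (D : Set R3) (S : Specimen) (y v x x' : R3) : Prop :=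
  x ∈ D ∧ x' ∈ D ∧ ∃ a b : ℝ, 0 ≤ a ∧ 0 ≤ b ∧ x = y - a • v ∧ x' = y + b • v ∧
    ∀ s : ℝ, y + s • v ∈ tsupport S.f → -a ≤ s ∧ s ≤ b

end

/-! A detector point `x` lies outside `tsupport S.f`, so `f` vanishes near `x` and `y ↦ K(t,x,y)
f(y)` is continuous with compact support. The Radon transform is injective on such functions
(Fourier slices and Fourier inversion), hence `S.inverted x y t` is simply `K(t,x,y) f(y)`
(`Admissible.inverted_eq`). What remains is the behaviour of the kernel in `t` for fixed `y`.

Near the arrival time `c = |y - x|`, the first term is quadratic in `t - c`. The two `ρ₁` terms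
carry weights of order one and two that vanish on the boundary of the spheroid, so their derivatives
tend to zero as the spheroid shrinks to a null set. In the `α₁` term, prolate spheroidal coordinates
have a Jacobian proportional to `|z - x| |z - y|`; it cancels the singular weight, and the term
becomes the primitive of a continuous density whose value at `c` is `2π / c` times the integral over
the segment `[x, y]` (`exists_confocal_density`). Thus `M0` is `f(y) / (8π c)` times the integral of
`ε α₁` over that segment, and the two detectors of a pair account for the whole line.

For large `t` the spheroid contains all supports, so the kernel is quadratic in `t`, and `Ninf` is
minus its linear coefficient times `f(y)`. The `ρ₁` contributions to that coefficient combine into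
the flux of `∇ρ₁` against `(z - y) / |z - y|³`. If `y` is outside the support of `ρ₁`, this is zero
because the Newtonian field is divergence free (`integral_gradient_newton`). If also `α₁ y = 0`,
only `-1 / (4π)` is left, so `f` is recovered (`Admissible.Ninf_eq`).

A given line may contain no point with `f ≠ 0` off the perturbations. But the last point of the line
in the support of `f` is not interior to it, hence is unperturbed, and nearby there are unperturbed
points with `f ≠ 0`. Continuity of the X-ray transform in the base point carries the formula over.
Uniqueness for two specimens uses the last point of the union of both supports and detector pairs
valid for both. -/

noncomputable section

/-! ### Injectivity of the Radon transform -/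

/-- Integration over space as iterated integration over parallel planes. -/
lemma integral_eq_integral_planes {F : R3 → ℂ} (hF : Integrable F) {θ : R3} (hθ : ‖θ‖ = 1) :
    ∫ v, F v = ∫ r : ℝ, ∫ w : (Submodule.span ℝ {θ}).orthogonal, F (r • θ + (w : R3)) := by
  let K := Submodule.span ℝ {θ}
  have h1 : MeasurePreserving (fun p : K × Kᗮ => (p.1 : R3) + p.2) := by
    have := K.orthogonalDecomposition.symm.measurePreserving.comp
      (WithLp.volume_preserving_toLp K Kᗮ)
    convert this using 1
    ext1 p; rfl
  have h2 : MeasurePreserving (fun p : ℝ × Kᗮ =>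
      ((LinearIsometryEquiv.toSpanUnitSingleton (𝕜 := ℝ) θ hθ p.1 : K), p.2)) :=
    ((LinearIsometryEquiv.toSpanUnitSingleton (𝕜 := ℝ) θ hθ).measurePreserving).prod
      (MeasurePreserving.id _)
  have h3 : MeasurePreserving (fun p : ℝ × Kᗮ => p.1 • θ + (p.2 : R3)) := by
    convert h1.comp h2 using 1
    ext1 p; rfl
  let e : (ℝ × Kᗮ) ≃ᵐ R3 :=
    (((LinearIsometryEquiv.toSpanUnitSingleton (𝕜 := ℝ) θ hθ).toHomeomorph.toMeasurableEquiv).prodCongr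
      (MeasurableEquiv.refl _)).trans ((MeasurableEquiv.toLp 2 (K × Kᗮ)).trans
        K.orthogonalDecomposition.symm.toHomeomorph.toMeasurableEquiv)
  have he : ⇑e = fun p : ℝ × Kᗮ => p.1 • θ + (p.2 : R3) := by
    ext1 p; rfl
  have hemb : MeasurableEmbedding (fun p : ℝ × Kᗮ => p.1 • θ + (p.2 : R3)) :=
    he ▸ e.measurableEmbedding
  rw [← h3.integral_comp hemb, Measure.volume_eq_prod, integral_prod]
  rw [← Measure.volume_eq_prod]
  exact (h3.integrable_comp_emb hemb).2 hF

lemma radon_neg (g : R3 → ℝ) (r : ℝ) (θ : R3) : radon g (-r) (-θ) = radon g r θ := by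
  have key : ∀ K L : Submodule ℝ R3, K = L → (∫ w : K.orthogonal, g (r • θ + (w : R3))) =
      ∫ w : L.orthogonal, g (r • θ + (w : R3)) := by rintro K _ rfl; rfl
  have : Submodule.span ℝ {-θ} = Submodule.span ℝ {θ} := by
    rw [← Set.neg_singleton, Submodule.span_neg]
  simpa [radon] using key _ _ this

/-- The Fourier slice theorem: on each plane orthogonal to `θ` the character with frequency `s • θ`
is constant and leaves the inner integral. -/
lemma fourier_eq_radon {g : R3 → ℝ} (hg : Integrable g) {θ : R3} (hθ : ‖θ‖ = 1) (s : ℝ) :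
    FourierTransform.fourier (fun y => (g y : ℂ)) (s • θ) =
      ∫ r : ℝ, (Real.fourierChar (-(r * s)) : ℂ) * (radon g r θ : ℂ) := by
  rw [Real.fourier_eq, integral_eq_integral_planes _ hθ]
  · congr 1; ext r
    unfold radon
    rw [← integral_complex_ofReal, ← integral_const_mul]
    congr 1; ext w
    have hw : inner ℝ (w : R3) θ = 0 := by
      rw [real_inner_comm]
      exact w.2 θ (Submodule.mem_span_singleton_self θ)
    have : inner ℝ (r • θ + (w : R3)) (s • θ) = r * s := by
      simp [inner_add_left, inner_smul_left, inner_smul_right, hw, hθ]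
      ring
    rw [this, Circle.smul_def, smul_eq_mul]
  · exact (Real.fourierIntegral_convergent_iff _).2 hg.ofReal

/-- By the slice theorem the difference has zero Fourier transform. This is integrable, so the
inversion formula for continuous integrable functions applies. -/
lemma radon_injective {g₁ g₂ : R3 → ℝ} (h₁ : Continuous g₁) (h₁' : HasCompactSupport g₁)
    (h₂ : Continuous g₂) (h₂' : HasCompactSupport g₂)
    (h : ∀ r θ, 0 ≤ r → ‖θ‖ = 1 → radon g₁ r θ = radon g₂ r θ) : g₁ = g₂ := by
  have h' : ∀ r θ, ‖θ‖ = 1 → radon g₁ r θ = radon g₂ r θ := by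
    intro r θ hθ
    rcases le_total 0 r with hr | hr
    · exact h r θ hr hθ
    · rw [← radon_neg g₁, ← radon_neg g₂]
      exact h _ _ (by linarith) (by simpa)
  have i₁ := h₁.integrable_of_hasCompactSupport h₁' (μ := volume)
  have i₂ := h₂.integrable_of_hasCompactSupport h₂' (μ := volume)
  have hF : ∀ ξ, FourierTransform.fourier (fun y => (g₁ y : ℂ)) ξ =
      FourierTransform.fourier (fun y => (g₂ y : ℂ)) ξ := by
    intro ξ
    obtain ⟨s, θ, hθ, rfl⟩ : ∃ (s : ℝ) (θ : R3), ‖θ‖ = 1 ∧ ξ = s • θ := by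
      by_cases hξ : ξ = 0
      · exact ⟨0, EuclideanSpace.single 0 1, by simp, by simp [hξ]⟩
      · exact ⟨‖ξ‖, ‖ξ‖⁻¹ • ξ, by simp [norm_smul, hξ], by simp [smul_smul, hξ]⟩
    rw [fourier_eq_radon i₁ hθ, fourier_eq_radon i₂ hθ]
    simp_rw [h' _ _ hθ]
  have hd : FourierTransform.fourier (fun y => (g₁ y : ℂ) - (g₂ y : ℂ)) = 0 := by
    ext ξ
    have := hF ξ
    rw [Real.fourier_eq] at this ⊢
    rw [Real.fourier_eq, ← sub_eq_zero, ← integral_sub] at this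
    · simp_rw [smul_sub]; exact this
    · exact (Real.fourierIntegral_convergent_iff _).2 i₁.ofReal
    · exact (Real.fourierIntegral_convergent_iff _).2 i₂.ofReal
  have hinv := Continuous.fourierInv_fourier_eq
    (f := fun y => (g₁ y : ℂ) - (g₂ y : ℂ)) (by fun_prop) (i₁.ofReal.sub i₂.ofReal)
    (by rw [hd]; exact integrable_zero _ _ _)
  rw [hd] at hinv
  ext y
  have := congrFun hinv y
  rw [Real.fourierInv_eq] at this
  simp at this
  exact_mod_cast (sub_eq_zero.1 this.symm)

/-- Injectivity makes the arbitrary choice in `radonInv` immaterial. -/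
lemma radonInv_radon {g : R3 → ℝ} (hg : Continuous g) (hg' : HasCompactSupport g) :
    radonInv (fun r θ => radon g r θ) = g := by
  have H : ∃ g' : R3 → ℝ, Continuous g' ∧ HasCompactSupport g' ∧
      IsRadonTransformOf (fun r θ => radon g r θ) g' := ⟨g, hg, hg', fun _ _ _ _ => rfl⟩
  unfold radonInv
  rw [dif_pos H]
  obtain ⟨a, b, c⟩ := H.choose_spec
  exact radon_injective a b hg hg' fun r θ hr hθ => (c r θ hr hθ).symm

/-! ### Prolate spheroidal coordinates -/

/-- The distance from the axis in prolate spheroidal coordinates `(s, η)` with foci at distance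
`c` from each other. -/
def prolateRadius (c s η : ℝ) : ℝ := √((s ^ 2 - c ^ 2) * (1 - η ^ 2)) / 2

/-- Prolate spheroidal coordinates `(s, η, φ)`: `s` is the sum of the distances to the foci
`(∓ c / 2, 0, 0)`, and `c * η` is their difference. -/
def prolate (c : ℝ) (p : Fin 3 → ℝ) : Fin 3 → ℝ :=
  ![p 0 * p 1 / 2, prolateRadius c (p 0) (p 1) * Real.cos (p 2),
    prolateRadius c (p 0) (p 1) * Real.sin (p 2)]

/-- The domain of prolate spheroidal coordinates. -/
def prolateDomain (c : ℝ) : Set (Fin 3 → ℝ) :=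
  {p | c < p 0 ∧ p 1 ∈ Set.Ioo (-1) 1 ∧ p 2 ∈ Set.Ioo (-Real.pi) Real.pi}

lemma measurableSet_prolateDomain (c : ℝ) : MeasurableSet (prolateDomain c) :=
  (measurableSet_lt measurable_const (measurable_pi_apply 0)).inter
    ((measurableSet_Ioo.preimage (measurable_pi_apply 1)).inter
      (measurableSet_Ioo.preimage (measurable_pi_apply 2)))

lemma continuous_prolate (c : ℝ) : Continuous (prolate c) := by
  unfold prolate prolateRadius
  refine continuous_pi fun i => ?_
  fin_cases i <;> simp <;> fun_prop

lemma prolate_arg_pos {c s η : ℝ} (hc : 0 < c) (hs : c < s) (hη : η ∈ Set.Ioo (-1 : ℝ) 1) :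
    0 < (s ^ 2 - c ^ 2) * (1 - η ^ 2) := by
  have h1 : 0 < s ^ 2 - c ^ 2 := by nlinarith
  have h2 : 0 < 1 - η ^ 2 := by nlinarith [hη.1, hη.2]
  positivity

lemma prolateRadius_pos {c s η : ℝ} (hc : 0 < c) (hs : c < s) (hη : η ∈ Set.Ioo (-1 : ℝ) 1) :
    0 < prolateRadius c s η :=
  div_pos (Real.sqrt_pos.2 (prolate_arg_pos hc hs hη)) two_pos

lemma prolateRadius_sq {c s η : ℝ} (hc : 0 < c) (hs : c < s) (hη : η ∈ Set.Ioo (-1 : ℝ) 1) :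
    prolateRadius c s η ^ 2 = (s ^ 2 - c ^ 2) * (1 - η ^ 2) / 4 := by
  unfold prolateRadius
  rw [div_pow, Real.sq_sqrt (prolate_arg_pos hc hs hη).le]; norm_num

/-- The Jacobian matrix of prolate spheroidal coordinates. -/
def prolateJacobian (c : ℝ) (p : Fin 3 → ℝ) : Matrix (Fin 3) (Fin 3) ℝ :=
  let ρ := prolateRadius c (p 0) (p 1)
  let ρs := p 0 * (1 - p 1 ^ 2) / (4 * ρ)
  let ρη := -((p 0 ^ 2 - c ^ 2) * p 1) / (4 * ρ)
  !![p 1 / 2, p 0 / 2, 0;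
    ρs * Real.cos (p 2), ρη * Real.cos (p 2), -ρ * Real.sin (p 2);
    ρs * Real.sin (p 2), ρη * Real.sin (p 2), ρ * Real.cos (p 2)]

/-- The value is half the product of the focal distances `(s + c η) / 2` and `(s - c η) / 2`, which
is what cancels the weight `1 / (|z - x| |z - y|)`. -/
lemma det_prolateJacobian {c : ℝ} (hc : 0 < c) {p : Fin 3 → ℝ} (hp : p ∈ prolateDomain c) :
    |(prolateJacobian c p).det| = (p 0 ^ 2 - c ^ 2 * p 1 ^ 2) / 8 := by
  have hρ := prolateRadius_pos hc hp.1 hp.2.1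
  have key : (prolateJacobian c p).det = -((p 0 ^ 2 - c ^ 2 * p 1 ^ 2) / 8) := by
    rw [prolateJacobian, Matrix.det_fin_three]
    simp
    field_simp
    have := Real.sin_sq_add_cos_sq (p 2)
    linear_combination 8 * (-p 1 ^ 2 * (p 0 ^ 2 - c ^ 2) - p 0 ^ 2 * (1 - p 1 ^ 2)) * this
  have hη := hp.2.1
  rw [key, abs_neg, abs_of_pos]
  have h2 : 0 < 1 - p 1 ^ 2 := by nlinarith [hη.1, hη.2]
  nlinarith [hp.1, mul_pos (mul_pos hc hc) h2]

lemma hasFDerivAt_prolate {c : ℝ} (hc : 0 < c) {p : Fin 3 → ℝ} (hp : p ∈ prolateDomain c) :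
    HasFDerivAt (prolate c) (Matrix.toLin' (prolateJacobian c p)).toContinuousLinearMap p := by
  have hρ := prolateRadius_pos hc hp.1 hp.2.1
  have hpos := prolate_arg_pos hc hp.1 hp.2.1
  have hp' : ∀ i : Fin 3, HasFDerivAt (fun q : Fin 3 → ℝ => q i)
    (ContinuousLinearMap.proj (R := ℝ) (φ := fun _ : Fin 3 => ℝ) i) p := fun i => hasFDerivAt_apply i p
  have hr : HasFDerivAt (fun q : Fin 3 → ℝ => prolateRadius c (q 0) (q 1))
      ((p 0 * (1 - p 1 ^ 2) / (4 * prolateRadius c (p 0) (p 1))) •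
        ContinuousLinearMap.proj (R := ℝ) (φ := fun _ : Fin 3 => ℝ) 0 +
       (-((p 0 ^ 2 - c ^ 2) * p 1) / (4 * prolateRadius c (p 0) (p 1))) •
        ContinuousLinearMap.proj (R := ℝ) (φ := fun _ : Fin 3 => ℝ) 1) p := by
    have h0 : HasFDerivAt (fun q : Fin 3 → ℝ => (q 0 ^ 2 - c ^ 2) * (1 - q 1 ^ 2)) _ p :=
      (((hp' 0).pow 2).sub_const (c ^ 2)).mul (((hp' 1).pow 2).const_sub 1)
    have h1 := (h0.sqrt hpos.ne').mul_const (1 / 2)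
    have e : (fun q : Fin 3 → ℝ => prolateRadius c (q 0) (q 1)) =
      fun q : Fin 3 → ℝ => √((q 0 ^ 2 - c ^ 2) * (1 - q 1 ^ 2)) * (1 / 2) := by
      ext q; simp [prolateRadius]; ring
    rw [e]
    refine h1.congr_fderiv ?_
    have hρ' : √((p 0 ^ 2 - c ^ 2) * (1 - p 1 ^ 2)) = 2 * prolateRadius c (p 0) (p 1) := by
      simp [prolateRadius]; ring
    rw [hρ']
    ext v
    simp
    field_simp
    ring
  rw [hasFDerivAt_pi']
  intro i
  fin_cases i
  · refine (((hp' 0).mul (hp' 1)).mul_const (1 / 2)).congr_fderiv ?_ |>.congr_of_eventuallyEq ?_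
    · ext v
      simp [prolateJacobian, Matrix.toLin'_apply, dotProduct, Fin.sum_univ_three]
      ring
    · refine Eventually.of_forall fun q => ?_
      simp [prolate]; ring
  · refine (hr.mul (hp' 2).cos).congr_fderiv ?_ |>.congr_of_eventuallyEq ?_
    · ext v
      simp [prolateJacobian, Matrix.toLin'_apply, dotProduct, Fin.sum_univ_three]
      ring
    · refine Eventually.of_forall fun q => ?_
      simp [prolate]
  · refine (hr.mul (hp' 2).sin).congr_fderiv ?_ |>.congr_of_eventuallyEq ?_
    · ext v
      simp [prolateJacobian, Matrix.toLin'_apply, dotProduct, Fin.sum_univ_three]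
      ring
    · refine Eventually.of_forall fun q => ?_
      simp [prolate]

/-- The sign `τ = ±1` treats both foci at once; each squared focal distance is a perfect square in
these coordinates. -/
lemma prolate_focal {c : ℝ} (hc : 0 < c) {p : Fin 3 → ℝ} (hp : p ∈ prolateDomain c) (τ : ℝ)
    (hτ : τ ^ 2 = 1) :
    (prolate c p 0 + τ * c / 2) ^ 2 + prolate c p 1 ^ 2 + prolate c p 2 ^ 2 =
      ((p 0 + τ * c * p 1) / 2) ^ 2 := by
  have h := prolateRadius_sq hc hp.1 hp.2.1
  have := Real.sin_sq_add_cos_sq (p 2)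
  simp [prolate]
  linear_combination h + prolateRadius c (p 0) (p 1) ^ 2 * this + (c ^ 2 / 4) * (1 - p 1 ^ 2) * hτ

lemma prolate_focal_pos {c : ℝ} (hc : 0 < c) {p : Fin 3 → ℝ} (hp : p ∈ prolateDomain c) :
    0 < p 0 + c * p 1 ∧ 0 < p 0 - c * p 1 := by
  obtain ⟨h1, ⟨h2, h3⟩, -⟩ := hp
  constructor <;> nlinarith

/-- The two focal distances determine `s` and `η`; the angle then follows from injectivity of polar
coordinates. -/
lemma injOn_prolate {c : ℝ} (hc : 0 < c) : Set.InjOn (prolate c) (prolateDomain c) := by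
  intro p hp q hq h
  have a1 := prolate_focal hc hp 1 (by norm_num)
  have a2 := prolate_focal hc hp (-1) (by norm_num)
  rw [h, prolate_focal hc hq _ (by norm_num)] at a1 a2
  obtain ⟨p1, p2⟩ := prolate_focal_pos hc hp
  obtain ⟨q1, q2⟩ := prolate_focal_pos hc hq
  have b1 := (sq_eq_sq₀ (by linarith) (by linarith)).1 a1
  have b2 := (sq_eq_sq₀ (by linarith) (by linarith)).1 a2
  have e0 : p 0 = q 0 := by linarith
  have e1 : p 1 = q 1 := by
    have : c * p 1 = c * q 1 := by linarith
    exact mul_left_cancel₀ hc.ne' this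
  have hρ := prolateRadius_pos hc hp.1 hp.2.1
  have e2 : p 2 = q 2 := by
    have := polarCoord.symm.injOn (x₁ := (prolateRadius c (p 0) (p 1), p 2))
      (x₂ := (prolateRadius c (p 0) (p 1), q 2)) ⟨hρ, hp.2.2⟩ ⟨hρ, hq.2.2⟩ (by
        have h1 := congrFun h 1
        have h2 := congrFun h 2
        simp [prolate] at h1 h2
        rw [← e0, ← e1] at h1 h2
        simp [h1, h2])
    exact congrArg Prod.snd this
  ext i; fin_cases i <;> assumption

/-- Excluding the plane `z 2 = 0` removes both the axis and the cut of the polar angle, at the price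
of a null set only. -/
lemma prolate_image {c : ℝ} (hc : 0 < c) :
    {z : Fin 3 → ℝ | z 2 ≠ 0} ⊆ prolate c '' prolateDomain c := by
  intro z hz
  have hzs : (z 1, z 2) ∈ polarCoord.source := Or.inr hz
  obtain ⟨hr, hφ⟩ := polarCoord.map_source hzs
  have hinv := polarCoord.left_inv hzs
  set r := (polarCoord (z 1, z 2)).1 with hr_def
  set φ := (polarCoord (z 1, z 2)).2 with hφ_def
  have hr : 0 < r := hr
  have i1 : r * Real.cos φ = z 1 := congrArg Prod.fst hinv
  have i2 : r * Real.sin φ = z 2 := congrArg Prod.snd hinv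
  set A := √((z 0 + c / 2) ^ 2 + r ^ 2) with hA
  set B := √((z 0 - c / 2) ^ 2 + r ^ 2) with hB
  have hA2 : A ^ 2 = (z 0 + c / 2) ^ 2 + r ^ 2 := Real.sq_sqrt (by positivity)
  have hB2 : B ^ 2 = (z 0 - c / 2) ^ 2 + r ^ 2 := Real.sq_sqrt (by positivity)
  have hAl : |z 0 + c / 2| < A := Real.lt_sqrt_of_sq_lt (by rw [sq_abs]; nlinarith)
  have hBl : |z 0 - c / 2| < B := Real.lt_sqrt_of_sq_lt (by rw [sq_abs]; nlinarith)
  rw [abs_lt] at hAl hBl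
  have hs : c < A + B := by linarith
  -- This is `A ^ 2 - B ^ 2`. Together with `A + B > 2 |z 0|` it gives `|A - B| < c`.
  have hprod : (A - B) * (A + B) = 2 * c * z 0 := by nlinarith
  have hη1 : A - B < c := by
    by_contra hcon
    have : c * (A + B) ≤ (A - B) * (A + B) := by nlinarith
    nlinarith
  have hη2 : -c < A - B := by
    by_contra hcon
    have : (A - B) * (A + B) ≤ -c * (A + B) := by nlinarith
    nlinarith
  have hη : (A - B) / c ∈ Set.Ioo (-1 : ℝ) 1 := by
    constructor
    · rw [lt_div_iff₀ hc]; linarith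
    · rw [div_lt_iff₀ hc]; linarith
  have hρ : prolateRadius c (A + B) ((A - B) / c) = r := by
    have h := prolateRadius_sq hc hs hη
    refine (sq_eq_sq₀ (prolateRadius_pos hc hs hη).le hr.le).1 ?_
    rw [h]
    field_simp
    have : (A - B) ^ 2 * (A + B) ^ 2 = 4 * c ^ 2 * z 0 ^ 2 := by
      rw [← mul_pow, hprod]; ring
    linear_combination -this + 2 * c ^ 2 * hA2 + 2 * c ^ 2 * hB2
  refine ⟨![A + B, (A - B) / c, φ], ⟨by simpa using hs, by simpa using hη, hφ⟩, ?_⟩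
  ext i
  fin_cases i
  · simp [prolate]
    field_simp
    linarith
  · simpa [prolate, hρ] using i1
  · simpa [prolate, hρ] using i2

lemma ae_coord_ne_zero : ∀ᵐ z : Fin 3 → ℝ, z 2 ≠ 0 := by
  have B : volume (LinearMap.ker (LinearMap.proj (R := ℝ) (φ := fun _ : Fin 3 => ℝ) 2) :
      Set (Fin 3 → ℝ)) = 0 := by
    apply Measure.addHaar_submodule
    rw [Ne, LinearMap.ker_eq_top]
    intro h
    have := congrArg (fun l => l (fun _ => (1 : ℝ))) h
    simp at this
  rw [ae_iff]
  convert B using 2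
  ext z; simp

/-- Integration in prolate spheroidal coordinates. -/
lemma integral_prolate {c : ℝ} (hc : 0 < c) (g : (Fin 3 → ℝ) → ℝ) :
    ∫ z, g z = ∫ p in prolateDomain c, (p 0 ^ 2 - c ^ 2 * p 1 ^ 2) / 8 * g (prolate c p) := by
  have h1 : prolate c '' prolateDomain c =ᵐ[volume] Set.univ := by
    rw [eventuallyEq_univ]
    filter_upwards [ae_coord_ne_zero] with z hz using prolate_image hc hz
  rw [← setIntegral_univ, ← setIntegral_congr_set h1,
    integral_image_eq_integral_abs_det_fderiv_smul volume (measurableSet_prolateDomain c)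
      (fun p hp => (hasFDerivAt_prolate hc hp).hasFDerivWithinAt) (injOn_prolate hc)]
  refine setIntegral_congr_fun (measurableSet_prolateDomain c) fun p hp => ?_
  simp only [LinearMap.det_toContinuousLinearMap, LinearMap.det_toLin', smul_eq_mul]
  rw [det_prolateJacobian hc hp]

/-! ### Integration over confocal spheroids -/

/-- The isometric frame with origin `m` and axes given by an orthonormal basis. -/
def frame (m : R3) (b : OrthonormalBasis (Fin 3) ℝ R3) (q : Fin 3 → ℝ) : R3 :=
  m + b.repr.symm (WithLp.toLp 2 q)

lemma continuous_frame (m : R3) (b : OrthonormalBasis (Fin 3) ℝ R3) : Continuous (frame m b) := by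
  unfold frame; fun_prop

lemma integral_frame (m : R3) (b : OrthonormalBasis (Fin 3) ℝ R3) (g : R3 → ℝ) :
    ∫ z, g z = ∫ q, g (frame m b q) := by
  have h : MeasurePreserving (frame m b) :=
    (measurePreserving_add_left volume m).comp
      (b.measurePreserving_repr_symm.comp (PiLp.volume_preserving_toLp (Fin 3)))
  have he : MeasurableEmbedding (frame m b) :=
    (Homeomorph.addLeft m).measurableEmbedding.comp
      (b.repr.symm.toHomeomorph.measurableEmbedding.comp
        (MeasurableEquiv.toLp 2 (Fin 3 → ℝ)).measurableEmbedding)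
  exact (h.integral_comp he g).symm

lemma norm_frame_sub (m : R3) (b : OrthonormalBasis (Fin 3) ℝ R3) (a : ℝ) (q : Fin 3 → ℝ) :
    ‖frame m b q - (m - a • b 0)‖ = √((q 0 + a) ^ 2 + q 1 ^ 2 + q 2 ^ 2) := by
  have : frame m b q - (m - a • b 0) =
      b.repr.symm (WithLp.toLp 2 q + a • EuclideanSpace.single 0 1) := by
    simp [frame]
  rw [this, LinearIsometryEquiv.norm_map, EuclideanSpace.norm_eq, Fin.sum_univ_three]
  simp

lemma exists_frame {e : R3} (he : ‖e‖ = 1) : ∃ b : OrthonormalBasis (Fin 3) ℝ R3, b 0 = e := by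
  have ho : Orthonormal ℝ (Set.domRestrict {(0 : Fin 3)} (fun _ => e)) := by
    constructor
    · intro i; exact he
    · intro i j hij
      exact absurd (Subsingleton.elim i j) hij
  obtain ⟨b, hb⟩ := ho.exists_orthonormalBasis_extension_of_card_eq (by simp)
  exact ⟨b, hb 0 rfl⟩

/-- The density of the integral over a family of confocal spheroids. -/
def confocalDensity (α : R3 → ℝ) (c : ℝ) (m : R3) (b : OrthonormalBasis (Fin 3) ℝ R3) (s : ℝ) : ℝ :=
  ∫ q : Fin 2 → ℝ in Set.Icc ![-1, -Real.pi] ![1, Real.pi],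
    α (frame m b (prolate c (Fin.cons s q))) / 2

lemma continuous_confocal_integrand {α : R3 → ℝ} (hα : Continuous α) (c : ℝ) (m : R3)
    (b : OrthonormalBasis (Fin 3) ℝ R3) :
    Continuous (fun p : ℝ × (Fin 2 → ℝ) =>
      α (frame m b (prolate c (Fin.cons (α := fun _ => ℝ) p.1 p.2))) / 2) := by
  refine (hα.comp ((continuous_frame m b).comp ((continuous_prolate c).comp ?_))).div_const 2
  refine continuous_pi fun i => ?_
  refine Fin.cases ?_ (fun j => ?_) i
  · simpa using continuous_fst
  · simpa [Function.comp_def] using (continuous_apply j).comp continuous_snd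

lemma continuous_confocalDensity {α : R3 → ℝ} (hα : Continuous α) (c : ℝ) (m : R3)
    (b : OrthonormalBasis (Fin 3) ℝ R3) : Continuous (confocalDensity α c m b) := by
  refine continuous_parametric_integral_of_continuous ?_ isCompact_Icc
  exact continuous_confocal_integrand hα c m b

/-- At `s = c` the radius is zero and the spheroid collapses to the focal segment: the integrand no
longer depends on the angle, whose integration gives `2π`. -/
lemma confocalDensity_self {α : R3 → ℝ} (hα : Continuous α) {c : ℝ} (hc : 0 < c) (m : R3)
    (b : OrthonormalBasis (Fin 3) ℝ R3) :
    confocalDensity α c m b c =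
      2 * Real.pi / c * ∫ r in (0 : ℝ)..c, α (m - (c / 2) • b 0 + r • b 0) := by
  have key : ∀ q : Fin 2 → ℝ, frame m b (prolate c (Fin.cons c q)) =
      m + (c * q 0 / 2) • b 0 := by
    intro q
    have : WithLp.toLp 2 (prolate c (Fin.cons c q)) =
        (c * q 0 / 2) • (EuclideanSpace.single 0 1 : R3) := by
      ext i
      fin_cases i <;> simp [prolate, prolateRadius]
    rw [frame, this]; simp
  unfold confocalDensity
  simp_rw [key]
  have hset : Set.Icc (![-1, -Real.pi] : Fin 2 → ℝ) ![1, Real.pi] = MeasurableEquiv.finTwoArrow ⁻¹'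
        (Set.Icc (-1 : ℝ) 1 ×ˢ Set.Icc (-Real.pi) Real.pi) := by
    ext q; simp [Pi.le_def, Fin.forall_fin_two]
  have := (volume_preserving_finTwoArrow ℝ).setIntegral_preimage_emb
    MeasurableEquiv.finTwoArrow.measurableEmbedding
    (fun p : ℝ × ℝ => α (m + (c * p.1 / 2) • b 0) / 2)
    (Set.Icc (-1 : ℝ) 1 ×ˢ Set.Icc (-Real.pi) Real.pi)
  rw [hset]
  refine Eq.trans this ?_
  rw [Measure.volume_eq_prod, setIntegral_prod]
  · simp only [integral_const]
    rw [integral_Icc_eq_integral_Ioc, ← intervalIntegral.integral_of_le (by norm_num)]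
    simp only [MeasurableSet.univ, measureReal_restrict_apply, Set.univ_inter, Real.volume_real_Icc,
      smul_eq_mul]
    rw [intervalIntegral.integral_const_mul, max_eq_left (by linarith [Real.pi_pos])]
    have h2 := intervalIntegral.integral_comp_mul_add (a := -1) (b := 1)
      (fun r => α (m - (c / 2) • b 0 + r • b 0)) (c := c / 2) (by positivity) (c / 2)
    rw [show c / 2 * -1 + c / 2 = 0 by ring, show c / 2 * 1 + c / 2 = c by ring] at h2
    rw [intervalIntegral.integral_div]
    have h3 : ∀ r : ℝ, m - (c / 2) • b 0 + (c / 2 * r + c / 2) • b 0 = m + (c * r / 2) • b 0 := by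
      intro r
      module
    simp_rw [h3] at h2
    rw [h2, smul_eq_mul]
    field_simp
    ring
  · have : Continuous (fun p : ℝ × ℝ => α (m + (c * p.1 / 2) • b 0) / 2) := by fun_prop
    exact this.continuousOn.integrableOn_compact (isCompact_Icc.prod isCompact_Icc)

/-- In prolate coordinates the spheroid is `s ≤ t`, and the Jacobian cancels the focal distances up
to the factor `1 / 2`. Fubini then leaves an integral in `s` alone. -/
lemma setIntegral_spheroid_eq {α : R3 → ℝ} (hα : Continuous α) {c t : ℝ} (hc : 0 < c) (m : R3)
    (b : OrthonormalBasis (Fin 3) ℝ R3) (ht : c ≤ t) :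
    ∫ z in spheroid t (m - (c / 2) • b 0) (m + (c / 2) • b 0),
      α z / (‖z - (m - (c / 2) • b 0)‖ * ‖z - (m + (c / 2) • b 0)‖) =
      ∫ s in c..t, confocalDensity α c m b s := by
  have hms : MeasurableSet (spheroid t (m - (c / 2) • b 0) (m + (c / 2) • b 0)) :=
    measurableSet_le (by fun_prop) measurable_const
  rw [← integral_indicator hms, integral_frame m b, integral_prolate hc,
    ← integral_indicator (measurableSet_prolateDomain c)]
  have hn : ∀ p ∈ prolateDomain c,
      ‖frame m b (prolate c p) - (m - (c / 2) • b 0)‖ = (p 0 + c * p 1) / 2 ∧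
      ‖frame m b (prolate c p) - (m + (c / 2) • b 0)‖ = (p 0 - c * p 1) / 2 := by
    intro p hp
    obtain ⟨h1, h2⟩ := prolate_focal_pos hc hp
    constructor
    · rw [norm_frame_sub]
      have := prolate_focal hc hp 1 (by norm_num)
      rw [one_mul] at this
      rw [this, Real.sqrt_sq (by linarith)]
    · rw [show m + (c / 2) • b 0 = m - (-(c / 2)) • b 0 by module, norm_frame_sub]
      have := prolate_focal hc hp (-1) (by norm_num)
      rw [show -1 * c / 2 = -(c / 2) by ring] at this
      rw [this, Real.sqrt_sq (by linarith)]
      ring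
  let B : Set (Fin 2 → ℝ) := Set.univ.pi fun i => Set.Ioo ((![-1, -Real.pi] : Fin 2 → ℝ) i)
      ((![1, Real.pi] : Fin 2 → ℝ) i)
  have hB : MeasurableSet B := MeasurableSet.univ_pi fun _ => measurableSet_Ioo
  let A : ℝ × (Fin 2 → ℝ) → ℝ := fun p =>
      α (frame m b (prolate c (Fin.cons (α := fun _ => ℝ) p.1 p.2))) / 2
  have hA : Continuous A := continuous_confocal_integrand hα c m b
  have hpt : ∀ p : Fin 3 → ℝ, (prolateDomain c).indicator (fun p =>
      (p 0 ^ 2 - c ^ 2 * p 1 ^ 2) / 8 *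
        (spheroid t (m - (c / 2) • b 0) (m + (c / 2) • b 0)).indicator
          (fun z => α z / (‖z - (m - (c / 2) • b 0)‖ * ‖z - (m + (c / 2) • b 0)‖))
          (frame m b (prolate c p))) p =
      (Set.Ioc c t ×ˢ B).indicator A (MeasurableEquiv.piFinSuccAbove (fun _ => ℝ) 0 p) := by
    intro p
    have hmem : MeasurableEquiv.piFinSuccAbove (fun _ : Fin 3 => ℝ) 0 p ∈ Set.Ioc c t ×ˢ B ↔
        p ∈ prolateDomain c ∧ p 0 ≤ t := by
      simp [B, prolateDomain, Set.mem_pi, Fin.forall_fin_two]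
      tauto
    by_cases hp : p ∈ prolateDomain c
    · obtain ⟨n1, n2⟩ := hn p hp
      obtain ⟨h1, h2⟩ := prolate_focal_pos hc hp
      rw [Set.indicator_of_mem hp]
      have hsph : frame m b (prolate c p) ∈
          spheroid t (m - (c / 2) • b 0) (m + (c / 2) • b 0) ↔ p 0 ≤ t := by
        rw [spheroid, Set.mem_ofPred_eq, n1, n2]
        ring_nf
      by_cases hpt : p 0 ≤ t
      · rw [Set.indicator_of_mem (hsph.2 hpt), Set.indicator_of_mem (hmem.2 ⟨hp, hpt⟩), n1, n2]
        have hcons : (Fin.cons (α := fun _ => ℝ)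
            (MeasurableEquiv.piFinSuccAbove (fun _ : Fin 3 => ℝ) 0 p).1
            (MeasurableEquiv.piFinSuccAbove (fun _ : Fin 3 => ℝ) 0 p).2) = p := by
          ext i
          refine Fin.cases ?_ (fun j => ?_) i <;> simp [Fin.tail]
        simp only [A]
        rw [hcons]
        field_simp
        ring
      · rw [Set.indicator_of_notMem (fun h => hpt (hsph.1 h)),
          Set.indicator_of_notMem (fun h => hpt (hmem.1 h).2), mul_zero]
    · rw [Set.indicator_of_notMem hp, Set.indicator_of_notMem (fun h => hp (hmem.1 h).1)]
  simp_rw [hpt]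
  rw [(volume_preserving_piFinSuccAbove (fun _ : Fin 3 => ℝ) 0).integral_comp
    (MeasurableEquiv.measurableEmbedding _) ((Set.Ioc c t ×ˢ B).indicator A),
    integral_indicator (measurableSet_Ioc.prod hB), Measure.volume_eq_prod, setIntegral_prod,
    intervalIntegral.integral_of_le ht]
  · refine setIntegral_congr_fun measurableSet_Ioc fun s _ => ?_
    -- The coordinate domain is an open box, whereas `confocalDensity` uses the closed one, whose
    -- compactness serves for continuity; they differ by a null set.
    exact setIntegral_congr_set Measure.univ_pi_Ioo_ae_eq_Icc
  · refine (hA.continuousOn.integrableOn_compact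
      (isCompact_Icc.prod (isCompact_Icc (a := ![-1, -Real.pi]) (b := ![1, Real.pi])))).mono_set (Set.prod_mono Set.Ioc_subset_Icc_self ?_)
    rw [← Set.pi_univ_Icc]
    exact Set.pi_mono fun _ _ => Set.Ioo_subset_Icc_self

/-- The integral of `α z / (|z - x| |z - y|)` over the confocal spheroids with foci `x` and `y`
is a primitive, with the mean of `α` over the segment between the foci as initial density. -/
lemma exists_confocal_density {α : R3 → ℝ} (hα : Continuous α) {x y : R3} (hxy : y ≠ x) :
    ∃ G : ℝ → ℝ, Continuous G ∧
      G ‖y - x‖ = 2 * Real.pi / ‖y - x‖ *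
        ∫ r in (0 : ℝ)..‖y - x‖, α (x + r • (‖y - x‖⁻¹ • (y - x))) ∧
      ∀ t, ‖y - x‖ ≤ t →
        ∫ z in spheroid t x y, α z / (‖z - x‖ * ‖z - y‖) = ∫ s in ‖y - x‖..t, G s := by
  set c := ‖y - x‖ with hc_def
  have hc : 0 < c := norm_pos_iff.2 (sub_ne_zero.2 hxy)
  obtain ⟨b, hb⟩ := exists_frame (e := c⁻¹ • (y - x))
    (by rw [norm_smul, norm_inv, norm_norm]; exact inv_mul_cancel₀ hc.ne')
  have hbc : c • b 0 = y - x := by rw [hb, smul_smul, mul_inv_cancel₀ hc.ne', one_smul]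
  have hx : x + (c / 2) • b 0 - (c / 2) • b 0 = x := by module
  have hy : x + (c / 2) • b 0 + (c / 2) • b 0 = y := by
    rw [add_assoc, ← add_smul, add_halves, hbc]; module
  refine ⟨confocalDensity α c (x + (c / 2) • b 0) b, continuous_confocalDensity hα _ _ _, ?_, ?_⟩
  · rw [confocalDensity_self hα hc, hx, hb]
  · intro t ht
    have := setIntegral_spheroid_eq hα hc (x + (c / 2) • b 0) b ht
    rwa [hx, hy] at this

/-! ### Null sets and continuity of spheroid integrals -/

lemma measurableSet_spheroid (t : ℝ) (x y : R3) : MeasurableSet (spheroid t x y) :=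
  measurableSet_le (by fun_prop) measurable_const

lemma convex_spheroid (t : ℝ) (x y : R3) : Convex ℝ (spheroid t x y) := by
  have h : ∀ p : R3, ConvexOn ℝ Set.univ (fun z : R3 => ‖z - p‖) := fun p => by
    simpa [dist_eq_norm] using convexOn_univ_dist p
  simpa [spheroid] using ((h x).add (h y)).convex_le t

/-- For `t > ‖y - x‖` the level set lies in the frontier of a convex set. Otherwise it lies on the
line through the foci, by equality in the triangle inequality. -/
lemma volume_spheroid_boundary (t : ℝ) (x y : R3) :
    volume {z : R3 | ‖z - x‖ + ‖z - y‖ = t} = 0 := by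
  rcases lt_or_ge ‖y - x‖ t with ht | ht
  · refine measure_mono_null ?_ ((convex_spheroid t x y).addHaar_frontier volume)
    intro z hz
    have hz : ‖z - x‖ + ‖z - y‖ = t := hz
    have hzm : z ∈ spheroid t x y := hz.le
    refine ⟨subset_closure hzm, fun hint => ?_⟩
    -- Stretching away from `y` by `1 + δ` raises the sum of focal distances to at least `t + δ (t -
    -- ‖y - x‖) > t`, so `z` cannot be interior.
    have hcont : ContinuousAt (fun δ : ℝ => z + δ • (z - y)) 0 := by fun_prop
    have hev : ∀ᶠ δ in 𝓝 (0 : ℝ), z + δ • (z - y) ∈ spheroid t x y :=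
      hcont.eventually_mem (by simpa using mem_interior_iff_mem_nhds.1 hint)
    obtain ⟨δ, hδ, hδ0⟩ := ((hev.filter_mono nhdsWithin_le_nhds).and
      (self_mem_nhdsWithin : Set.Ioi (0 : ℝ) ∈ 𝓝[>] 0)).exists
    have hδ0 : 0 < δ := hδ0
    have e1 : ‖z + δ • (z - y) - y‖ = (1 + δ) * ‖z - y‖ := by
      rw [show z + δ • (z - y) - y = (1 + δ) • (z - y) by module, norm_smul, Real.norm_of_nonneg]
      positivity
    have e2 : (1 + δ) * ‖z - x‖ ≤ ‖z + δ • (z - y) - x‖ + δ * ‖y - x‖ := by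
      have : (1 + δ) • (z - x) = (z + δ • (z - y) - x) + δ • (y - x) := by module
      have h := norm_add_le (z + δ • (z - y) - x) (δ • (y - x))
      rw [← this, norm_smul, norm_smul, Real.norm_of_nonneg (by positivity),
        Real.norm_of_nonneg hδ0.le] at h
      exact h
    have hδ : ‖z + δ • (z - y) - x‖ + ‖z + δ • (z - y) - y‖ ≤ t := hδ
    rw [e1] at hδ
    nlinarith
  · have hlt : line[ℝ, x, y] ≠ ⊤ := by
      intro h
      have h1 := finrank_vectorSpan_insert_le_set ℝ ({y} : Set R3) x
      have h2 : vectorSpan ℝ ({x, y} : Set R3) = ⊤ := by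
        rw [← direction_affineSpan, h, AffineSubspace.direction_top]
      rw [h2, vectorSpan_singleton] at h1
      simp at h1
    refine measure_mono_null ?_ (Measure.addHaar_affineSubspace volume _ hlt)
    intro z hz
    have hz : ‖z - x‖ + ‖z - y‖ = t := hz
    have : Wbtw ℝ x z y := by
      rw [← dist_add_dist_eq_iff]
      refine le_antisymm ?_ (dist_triangle _ _ _)
      rw [dist_comm x z, dist_eq_norm, dist_eq_norm, dist_comm x y, dist_eq_norm]
      linarith
    exact this.mem_affineSpan

lemma ae_norm_add_ne (t : ℝ) (x y : R3) : ∀ᵐ z : R3, ‖z - x‖ + ‖z - y‖ ≠ t := by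
  rw [ae_iff]; simpa using volume_spheroid_boundary t x y

lemma volume_spheroid_degenerate (x y : R3) : volume (spheroid ‖y - x‖ x y) = 0 := by
  refine measure_mono_null (fun z hz => ?_) (volume_spheroid_boundary ‖y - x‖ x y)
  refine le_antisymm hz ?_
  have := norm_sub_le (z - x) (z - y)
  rwa [sub_sub_sub_cancel_left] at this

lemma spheroid_eq_empty {t : ℝ} {x y : R3} (h : t < ‖y - x‖) : spheroid t x y = ∅ := by
  ext z
  simp only [spheroid, Set.mem_ofPred_eq, Set.mem_empty_iff_false, iff_false, not_le]
  have := norm_sub_le (z - x) (z - y)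
  rw [sub_sub_sub_cancel_left] at this
  linarith

/-- Continuity in the moving focus of weakly singular integrals over spheroids. -/
lemma continuous_setIntegral_spheroid (k : ℕ) (t : ℝ) (x : R3) {κ : R3 → R3 → ℝ} {b : R3 → ℝ}
    (hm : Measurable (Function.uncurry κ)) (hκ : ∀ w, Continuous fun z => κ z w)
    (hb : ∀ z w, |κ z w| ≤ b w) (hbi : IntegrableOn b (Metric.closedBall 0 t)) :
    Continuous fun y => ∫ z in spheroid t x y, (t - ‖z - x‖ - ‖z - y‖) ^ k * κ z (z - y) := by
  -- Substituting `z = y + w` fixes the singularity at `w = 0`, so one integrable majorant serves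
  -- for all `y`.
  let F : R3 → R3 → ℝ := fun y w => (spheroid t (x - y) 0).indicator
    (fun w => (t - ‖w - (x - y)‖ - ‖w‖) ^ k * κ (y + w) w) w
  have hF : ∀ y, ∫ z in spheroid t x y, (t - ‖z - x‖ - ‖z - y‖) ^ k * κ z (z - y) =
      ∫ w, F y w := by
    intro y
    rw [← integral_indicator (measurableSet_spheroid t x y), ← integral_add_left_eq_self _ y]
    congr 1; ext w
    have e : y + w - x = w - (x - y) := by abel
    simp only [F, Set.indicator_apply, spheroid, Set.mem_ofPred_eq, e, add_sub_cancel_left, sub_zero]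
  simp_rw [hF]
  rw [continuous_iff_continuousAt]
  intro y
  refine continuousAt_of_dominated (bound := (Metric.closedBall 0 t).indicator
    fun w => t ^ k * b w) ?_ ?_ ?_ ?_
  · refine Eventually.of_forall fun y => Measurable.aestronglyMeasurable ?_
    refine Measurable.indicator ?_ (measurableSet_spheroid t (x - y) 0)
    refine Measurable.mul (by fun_prop) (hm.comp (by fun_prop : Measurable fun w => (y + w, w)))
  · refine Eventually.of_forall fun y => Eventually.of_forall fun w => ?_
    have hb0 : 0 ≤ b w := (abs_nonneg _).trans (hb 0 w)
    by_cases h : ‖w - (x - y)‖ + ‖w - 0‖ ≤ t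
    · have h' := h
      rw [sub_zero] at h'
      have hw : w ∈ Metric.closedBall (0 : R3) t := by
        rw [mem_closedBall_zero_iff]; linarith [norm_nonneg (w - (x - y))]
      simp only [F]
      rw [Set.indicator_of_mem (show w ∈ spheroid t (x - y) 0 from h), Set.indicator_of_mem hw, norm_mul, norm_pow]
      have h0 : 0 ≤ t - ‖w - (x - y)‖ - ‖w‖ := by linarith
      rw [Real.norm_of_nonneg h0]
      refine mul_le_mul (pow_le_pow_left₀ h0 ?_ k) (hb _ _) (abs_nonneg _) (pow_nonneg ?_ k) <;>
        linarith [norm_nonneg (w - (x - y)), norm_nonneg w]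
    · simp only [F]
      rw [Set.indicator_of_notMem (show w ∉ spheroid t (x - y) 0 from h), norm_zero]
      refine Set.indicator_nonneg (fun w hw => ?_) _
      have : 0 ≤ t := (norm_nonneg _).trans (mem_closedBall_zero_iff.1 hw)
      have := (abs_nonneg _).trans (hb 0 w)
      positivity
  · rw [integrable_indicator_iff Metric.isClosed_closedBall.measurableSet]
    exact hbi.const_mul _
  -- Off the null boundary, membership in the spheroid is locally constant in `y`.
  · filter_upwards [ae_norm_add_ne t (x - y) 0] with w hw
    have hcn : ContinuousAt (fun y : R3 => ‖w - (x - y)‖ + ‖w - 0‖) y := by fun_prop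
    rcases lt_or_gt_of_ne hw with h | h
    · have he : (fun y => F y w) =ᶠ[𝓝 y]
          fun y => (t - ‖w - (x - y)‖ - ‖w‖) ^ k * κ (y + w) w := by
        filter_upwards [hcn.eventually_lt continuousAt_const h] with y' hy'
        simp only [F]
        rw [Set.indicator_of_mem (show w ∈ spheroid t (x - y') 0 from le_of_lt hy')]
      refine ContinuousAt.congr ?_ he.symm
      have := (hκ w).comp (by fun_prop : Continuous fun y : R3 => y + w)
      have h2 : Continuous fun y => (t - ‖w - (x - y)‖ - ‖w‖) ^ k * κ (y + w) w :=
        Continuous.mul (by fun_prop) this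
      exact h2.continuousAt
    · have he : (fun y => F y w) =ᶠ[𝓝 y] fun _ => 0 := by
        filter_upwards [continuousAt_const.eventually_lt hcn h] with y' hy'
        simp only [F]
        rw [Set.indicator_of_notMem (show w ∉ spheroid t (x - y') 0 from not_le.2 hy')]
      exact continuousAt_const.congr he.symm

/-! ### Moments as functions of time -/

/-- The integral of `Ψ` over a spheroid, weighted with a power of the distance to the boundary. -/
def spheroidMoment (Ψ : R3 → ℝ) (x y : R3) (k : ℕ) (t : ℝ) : ℝ :=
  ∫ z in spheroid t x y, (t - ‖z - x‖ - ‖z - y‖) ^ k * Ψ z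

lemma spheroidMoment_degenerate (Ψ : R3 → ℝ) (x y : R3) (k : ℕ) :
    spheroidMoment Ψ x y k ‖y - x‖ = 0 := by
  unfold spheroidMoment
  rw [Measure.restrict_eq_zero.2 (volume_spheroid_degenerate x y), integral_zero_measure]

lemma continuous_spheroidMoment_zero {Ψ : R3 → ℝ} (hΨ : Integrable Ψ) (x y : R3) :
    Continuous (spheroidMoment Ψ x y 0) := by
  have e : spheroidMoment Ψ x y 0 = fun t => ∫ z, (spheroid t x y).indicator Ψ z := by
    ext t
    rw [integral_indicator (measurableSet_spheroid t x y)]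
    simp [spheroidMoment]
  rw [e, continuous_iff_continuousAt]
  intro t
  refine continuousAt_of_dominated (bound := fun z => ‖Ψ z‖) ?_ ?_ hΨ.norm ?_
  · exact Eventually.of_forall fun t =>
      hΨ.aestronglyMeasurable.indicator (measurableSet_spheroid t x y)
  · exact Eventually.of_forall fun t => Eventually.of_forall fun z =>
      norm_indicator_le_norm_self _ _
  · filter_upwards [ae_norm_add_ne t x y] with z hz
    rcases lt_or_gt_of_ne hz with h | h
    · refine continuousAt_const (y := Ψ z) |>.congr ?_
      filter_upwards [lt_mem_nhds h] with t' ht'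
      rw [Set.indicator_of_mem (show z ∈ spheroid t' x y from le_of_lt ht')]
    · refine continuousAt_const (y := (0 : ℝ)) |>.congr ?_
      filter_upwards [gt_mem_nhds h] with t' ht'
      rw [Set.indicator_of_notMem (show z ∉ spheroid t' x y from not_le.2 ht')]

/-- Replacing the domain by the truncation `max (·) 0` makes the integrand Lipschitz in `t`. The
weight vanishes on the moving boundary, so no boundary term arises. -/
lemma hasDerivAt_spheroidMoment {Ψ : R3 → ℝ} (hΨ : Integrable Ψ) (x y : R3) (k : ℕ) (t : ℝ) :
    HasDerivAt (spheroidMoment Ψ x y (k + 1)) ((k + 1) * spheroidMoment Ψ x y k t) t := by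
  let F : ℝ → R3 → ℝ := fun t z => (max (t - ‖z - x‖ - ‖z - y‖) 0) ^ (k + 1) * Ψ z
  let F' : R3 → ℝ := (spheroid t x y).indicator
    fun z => (k + 1) * ((t - ‖z - x‖ - ‖z - y‖) ^ k * Ψ z)
  have e : spheroidMoment Ψ x y (k + 1) = fun t => ∫ z, F t z := by
    ext t
    rw [spheroidMoment, ← integral_indicator (measurableSet_spheroid t x y)]
    congr 1; ext z
    by_cases h : z ∈ spheroid t x y
    · have h' : ‖z - x‖ + ‖z - y‖ ≤ t := h
      simp only [F]
      rw [Set.indicator_of_mem h, max_eq_left (by linarith)]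
    · have h' : ¬ ‖z - x‖ + ‖z - y‖ ≤ t := h
      simp only [F]
      rw [Set.indicator_of_notMem h, max_eq_right (by linarith)]
      simp
  have e' : (k + 1) * spheroidMoment Ψ x y k t = ∫ z, F' z := by
    rw [integral_indicator (measurableSet_spheroid t x y), integral_const_mul, spheroidMoment]
  have hmF : ∀ t, AEStronglyMeasurable (F t) volume := fun t =>
    (by fun_prop : Continuous fun z : R3 =>
      (max (t - ‖z - x‖ - ‖z - y‖) 0) ^ (k + 1)).aestronglyMeasurable.mul hΨ.aestronglyMeasurable
  have hle : ∀ (s : ℝ) (z : R3), s ∈ Metric.ball t 1 →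
      |max (s - ‖z - x‖ - ‖z - y‖) 0| ≤ |t| + 1 := by
    intro s z hs
    rw [abs_of_nonneg (le_max_right _ _)]
    refine max_le ?_ (by positivity)
    have h1 := (abs_lt.1 (by simpa [Real.dist_eq] using hs : |s - t| < 1)).2
    linarith [le_abs_self t, norm_nonneg (z - x), norm_nonneg (z - y)]
  rw [e, e']
  refine (hasDerivAt_integral_of_dominated_loc_of_lip (F := F) (F' := F') (x₀ := t)
    (s := Metric.ball t 1)
    (bound := fun z => (k + 1) * (|t| + 1) ^ k * |Ψ z|) (Metric.ball_mem_nhds t one_pos)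
    (Eventually.of_forall hmF) ?_ ?_ ?_ ?_ ?_).2
  · refine (hΨ.norm.const_mul ((|t| + 1) ^ (k + 1))).mono' (hmF t) (Eventually.of_forall fun z => ?_)
    simp only [F]
    rw [norm_mul, norm_pow]
    gcongr
    exact hle t z (Metric.mem_ball_self one_pos)
  · refine AEStronglyMeasurable.indicator ?_ (measurableSet_spheroid t x y)
    refine AEStronglyMeasurable.const_mul ?_ _
    exact (by fun_prop : Continuous fun z : R3 =>
      (t - ‖z - x‖ - ‖z - y‖) ^ k).aestronglyMeasurable.mul hΨ.aestronglyMeasurable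
  · refine Eventually.of_forall fun z => LipschitzOnWith.of_dist_le_mul fun s hs s' hs' => ?_
    simp only [F, Real.dist_eq]
    rw [← sub_mul, abs_mul, Real.coe_nnabs, abs_of_nonneg (by positivity : (0 : ℝ) ≤ (k + 1) * (|t| + 1) ^ k * |Ψ z|)]
    have h1 := abs_pow_sub_pow_le (max (s - ‖z - x‖ - ‖z - y‖) 0) (max (s' - ‖z - x‖ - ‖z - y‖) 0) (k + 1)
    have h2 : |max (s - ‖z - x‖ - ‖z - y‖) 0 - max (s' - ‖z - x‖ - ‖z - y‖) 0| ≤ |s - s'| := by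
      refine (abs_max_sub_max_le_abs _ _ _).trans_eq ?_
      congr 1; ring
    have h3 : max |max (s - ‖z - x‖ - ‖z - y‖) 0| |max (s' - ‖z - x‖ - ‖z - y‖) 0| ≤ |t| + 1 :=
      max_le (hle s z hs) (hle s' z hs')
    push_cast at h1
    calc _ ≤ (|s - s'| * (k + 1) * (|t| + 1) ^ k) * |Ψ z| := by
            refine mul_le_mul_of_nonneg_right (h1.trans ?_) (abs_nonneg _)
            gcongr
      _ = _ := by ring
  · exact (hΨ.norm.const_mul _)
  · filter_upwards [ae_norm_add_ne t x y] with z hz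
    rcases lt_or_gt_of_ne hz with h | h
    · have h1 : HasDerivAt (fun s => (s - ‖z - x‖ - ‖z - y‖) ^ (k + 1) * Ψ z)
          (((k + 1 : ℕ) * (t - ‖z - x‖ - ‖z - y‖) ^ k * 1) * Ψ z) t := by
        have := (((hasDerivAt_id t).sub_const ‖z - x‖).sub_const ‖z - y‖).pow (k + 1)
        exact this.mul_const (Ψ z)
      simp only [F', Set.indicator_of_mem (show z ∈ spheroid t x y from le_of_lt h)]
      refine (h1.congr_deriv (by push_cast; ring)).congr_of_eventuallyEq ?_
      filter_upwards [lt_mem_nhds h] with s hs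
      simp only [F]
      rw [max_eq_left (by linarith)]
    · simp only [F', Set.indicator_of_notMem (show z ∉ spheroid t x y from not_le.2 h)]
      refine (hasDerivAt_const t (0 : ℝ)).congr_of_eventuallyEq ?_
      filter_upwards [gt_mem_nhds h] with s hs
      simp only [F]
      rw [max_eq_right (by linarith)]
      simp

lemma continuous_spheroidMoment {Ψ : R3 → ℝ} (hΨ : Integrable Ψ) (x y : R3) :
    ∀ k, Continuous (spheroidMoment Ψ x y k)
  | 0 => continuous_spheroidMoment_zero hΨ x y
  | k + 1 => continuous_iff_continuousAt.2 fun t => (hasDerivAt_spheroidMoment hΨ x y k t).continuousAt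

/-- When the support of `Ψ` is inside of the spheroid, the truncation is immaterial. -/
lemma spheroidMoment_eq_integral {Ψ : R3 → ℝ} (hΨ : HasCompactSupport Ψ) (x y : R3) :
    ∀ᶠ t in atTop, ∀ k, spheroidMoment Ψ x y k t =
      ∫ z, (t - ‖z - x‖ - ‖z - y‖) ^ k * Ψ z := by
  obtain ⟨T, hT⟩ := hΨ.isCompact.bddAbove_image
    (f := fun z : R3 => ‖z - x‖ + ‖z - y‖) (by fun_prop)
  filter_upwards [eventually_ge_atTop T] with t ht k
  rw [spheroidMoment, setIntegral_eq_integral_of_forall_compl_eq_zero]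
  intro z hz
  have : z ∉ tsupport Ψ := fun h => hz (le_trans (hT ⟨z, h, rfl⟩) ht)
  rw [image_eq_zero_of_notMem_tsupport this, mul_zero]

/-! ### The flux against the Newtonian field -/

/-- Integration by parts in each coordinate; the `3` is the divergence of `z - y`. -/
lemma integral_fderiv_radial {Q : R3 → ℝ} (hQ : ContDiff ℝ 1 Q) (hc : HasCompactSupport Q) (y : R3) :
    ∫ z, fderiv ℝ Q z (z - y) = - (3 * ∫ z, Q z) := by
  have hdc : HasCompactSupport (fderiv ℝ Q) := hc.fderiv ℝ
  have hcont : Continuous (fderiv ℝ Q) := hQ.continuous_fderiv (by norm_num)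
  have hg : ∀ (i : Fin 3) (z : R3), HasFDerivAt (fun z : R3 => z i - y i)
      (EuclideanSpace.proj i : R3 →L[ℝ] ℝ) z := fun i z =>
    ((EuclideanSpace.proj i : R3 →L[ℝ] ℝ).hasFDerivAt).sub_const (y i)
  have hint : ∀ i : Fin 3, Integrable
      (fun z => fderiv ℝ Q z (EuclideanSpace.single i 1) * (z i - y i)) := fun i =>
    Continuous.integrable_of_hasCompactSupport (by fun_prop)
      ((hdc.comp_left (g := fun l : R3 →L[ℝ] ℝ => l (EuclideanSpace.single i 1)) rfl).mul_right)
  have key : ∀ i : Fin 3, ∫ z, fderiv ℝ Q z (EuclideanSpace.single i 1) * (z i - y i) =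
      - ∫ z, Q z := by
    intro i
    have := integral_mul_fderiv_eq_neg_fderiv_mul_of_integrable (μ := volume)
      (f := Q) (g := fun z : R3 => z i - y i) (v := EuclideanSpace.single i 1) (𝕜 := ℝ) (hint i)
      (by
        simp_rw [(hg i _).fderiv]
        exact (hQ.continuous.integrable_of_hasCompactSupport hc).mul_const _)
      (Continuous.integrable_of_hasCompactSupport (by fun_prop) hc.mul_right)
      (fun z _ => hQ.differentiable (by norm_num) z) (fun z _ => (hg i z).differentiableAt)
    simp_rw [(hg i _).fderiv] at this
    simp at this
    linarith
  have hsum : ∀ z, fderiv ℝ Q z (z - y) =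
      ∑ i : Fin 3, fderiv ℝ Q z (EuclideanSpace.single i 1) * (z i - y i) := by
    intro z
    conv_lhs => rw [← (EuclideanSpace.basisFun (Fin 3) ℝ).sum_repr (z - y), map_sum]
    simp [mul_comm]
  simp_rw [hsum]
  rw [integral_finsetSum _ fun i _ => hint i]
  simp [key]

/-- The flux of the gradient of a function vanishing near `y`, against the Newtonian field of a
point charge at `y`, vanishes. -/
lemma integral_gradient_newton {ρ : R3 → ℝ} (hρ : ContDiff ℝ 1 ρ) (hc : HasCompactSupport ρ)
    {y : R3} (hy : y ∉ tsupport ρ) :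
    ∫ z, inner ℝ (gradient ρ z) (z - y) * (‖z - y‖ ^ 3)⁻¹ = 0 := by
  let G : R3 → ℝ := fun z => (‖z - y‖ ^ 3)⁻¹
  let Q : R3 → ℝ := fun z => ρ z * G z
  have hz : ∀ z, z ≠ y → z - y ≠ 0 := fun z => sub_ne_zero.2
  have hN : ∀ z, z ≠ y → ContDiffAt ℝ 1 (fun z : R3 => ‖z - y‖) z := fun z h =>
    (contDiffAt_id.sub contDiffAt_const).norm ℝ (hz z h)
  have hG : ∀ z, z ≠ y → ContDiffAt ℝ 1 G z := fun z h =>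
    ((hN z h).pow 3).inv (pow_ne_zero 3 (norm_ne_zero_iff.2 (hz z h)))
  -- The singularity of `G` at `y` is invisible because `ρ` vanishes near `y`.
  have hQ : ContDiff ℝ 1 Q := by
    rw [contDiff_iff_contDiffAt]
    intro z
    by_cases h : z ∈ tsupport ρ
    · exact hρ.contDiffAt.mul (hG z (fun e => hy (e ▸ h)))
    · refine (contDiffAt_const (c := (0 : ℝ))).congr_of_eventuallyEq ?_
      filter_upwards [notMem_tsupport_iff_eventuallyEq.1 h] with w hw
      simp only [Q]
      rw [hw]; simp
  have hQc : HasCompactSupport Q := hc.mul_right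
  have hdN : ∀ z, z ≠ y → fderiv ℝ (fun z : R3 => ‖z - y‖) z (z - y) = ‖z - y‖ := by
    intro z h
    have hd : DifferentiableAt ℝ (fun w : R3 => ‖w‖) (z - y) :=
      (contDiffAt_norm ℝ (hz z h)).differentiableAt (n := 1) (by norm_num)
    rw [fderiv_comp_sub (f := fun w : R3 => ‖w‖)]
    exact hd.fderiv_norm_self
  have hdG : ∀ z, z ≠ y → fderiv ℝ G z (z - y) = -3 * G z := by
    intro z h
    have h0 : ‖z - y‖ ≠ 0 := norm_ne_zero_iff.2 (hz z h)
    have h1 := (((hN z h).differentiableAt (by norm_num)).hasFDerivAt.pow 3)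
    have h2 := (hasDerivAt_inv (pow_ne_zero 3 h0)).comp_hasFDerivAt z h1
    have h3 : fderiv ℝ G z = _ := h2.fderiv
    rw [h3]
    simp [hdN z h, G]
    field_simp
  -- Since `G` is homogeneous of degree `-3` about `y`, the integrand is the divergence of `Q z • (z
  -- - y)`.
  have hmain : ∀ z, inner ℝ (gradient ρ z) (z - y) * (‖z - y‖ ^ 3)⁻¹ =
      fderiv ℝ Q z (z - y) + 3 * Q z := by
    intro z
    by_cases h : z = y
    · have : Q z = 0 := by simp [Q, h, image_eq_zero_of_notMem_tsupport hy]
      simp [h] at this ⊢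
      exact this
    · have h1 : fderiv ℝ Q z = _ :=
        ((hρ.differentiable (by norm_num)) z).hasFDerivAt.mul
          ((hG z h).differentiableAt (by norm_num)).hasFDerivAt |>.fderiv
      have hg : inner ℝ (gradient ρ z) (z - y) = fderiv ℝ ρ z (z - y) := by
        rw [gradient, InnerProductSpace.toDual_symm_apply]
      rw [h1, hg]
      simp [hdG z h, Q]
      simp only [G]; ring
  simp_rw [hmain]
  rw [integral_add, integral_fderiv_radial hQ hQc, integral_const_mul]
  · ring
  · have hdc : HasCompactSupport (fderiv ℝ Q) := hQc.fderiv ℝ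
    have hcont : Continuous (fderiv ℝ Q) := hQ.continuous_fderiv (by norm_num)
    refine Continuous.integrable_of_hasCompactSupport (by fun_prop) ?_
    refine hdc.mono fun z hz => ?_
    contrapose! hz
    simp only [Function.mem_support, not_not] at hz ⊢
    simp [hz]
  · exact (hQ.continuous.integrable_of_hasCompactSupport hQc).const_mul 3

/-! ### Weakly singular kernels -/

/-- Weakly singular kernels `κ z (z - y)` with compact support in `z`. -/
structure WeakKernel (κ : R3 → R3 → ℝ) : Prop where
  measurable : Measurable (Function.uncurry κ)
  continuous_left : ∀ w, Continuous fun z => κ z w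
  exists_bound : ∃ b : R3 → ℝ, LocallyIntegrable b ∧ ∀ z w, |κ z w| ≤ b w
  exists_compact : ∃ K : Set R3, IsCompact K ∧ ∀ z ∉ K, ∀ w, κ z w = 0

lemma WeakKernel.hasCompactSupport {κ : R3 → R3 → ℝ} (h : WeakKernel κ) (y : R3) :
    HasCompactSupport fun z => κ z (z - y) := by
  obtain ⟨K, hK, hK0⟩ := h.exists_compact
  exact HasCompactSupport.intro hK fun z hz => hK0 z hz _

lemma WeakKernel.integrable {κ : R3 → R3 → ℝ} (h : WeakKernel κ) (y : R3) :
    Integrable fun z => κ z (z - y) := by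
  obtain ⟨b, hb, hκb⟩ := h.exists_bound
  have hc := h.hasCompactSupport y
  have hm : Measurable fun z => κ z (z - y) :=
    h.measurable.comp (by fun_prop : Measurable fun z : R3 => (z, z - y))
  have hemb : MeasurableEmbedding fun z : R3 => z - y :=
    (Homeomorph.subRight y).measurableEmbedding
  have hbi : IntegrableOn (fun z => b (z - y)) (tsupport fun z => κ z (z - y)) := by
    have h1 := hb.integrableOn_isCompact
      (hc.isCompact.image (by fun_prop : Continuous fun z : R3 => z - y))
    rw [(measurePreserving_sub_right volume y).integrableOn_image hemb] at h1
    exact h1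
  refine (integrableOn_iff_integrable_of_support_subset (subset_tsupport _)).1 ?_
  exact Integrable.mono' hbi hm.aestronglyMeasurable (Eventually.of_forall fun z => hκb _ _)

lemma WeakKernel.continuous_setIntegral {κ : R3 → R3 → ℝ} (h : WeakKernel κ) (k : ℕ) (t : ℝ)
    (x : R3) : Continuous fun y => spheroidMoment (fun z => κ z (z - y)) x y k t := by
  obtain ⟨b, hb, hκb⟩ := h.exists_bound
  exact continuous_setIntegral_spheroid k t x h.measurable h.continuous_left hκb
    (hb.integrableOn_isCompact (isCompact_closedBall 0 t))

lemma locallyIntegrable_inv_norm_pow (C : ℝ) {p : ℕ} (hp : p < 3) :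
    LocallyIntegrable fun w : R3 => C * ‖w‖⁻¹ ^ p := by
  refine locallyIntegrable_of_norm_le_rpow (C := |C|) (α := p) (by simp) (by simpa using hp) ?_
    (Measurable.aestronglyMeasurable (by fun_prop))
  refine Eventually.of_forall fun w => ?_
  rw [Real.rpow_neg (norm_nonneg _), Real.rpow_natCast, norm_mul, Real.norm_eq_abs, norm_pow,
    norm_inv, norm_norm, inv_pow]

lemma WeakKernel.of_scalar {a : R3 → ℝ} (ha : Continuous a) (hc : HasCompactSupport a) :
    WeakKernel fun z w => a z * ‖w‖⁻¹ where
  measurable := by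
    have := ha.measurable
    exact (this.comp measurable_fst).mul (measurable_snd.norm.inv)
  continuous_left w := by fun_prop
  exists_bound := by
    obtain ⟨C, hC⟩ := hc.exists_bound_of_continuous ha
    refine ⟨fun w => C * ‖w‖⁻¹ ^ 1, locallyIntegrable_inv_norm_pow C (by norm_num), fun z w => ?_⟩
    change _ ≤ C * ‖w‖⁻¹ ^ 1
    rw [abs_mul, abs_inv, abs_norm, pow_one]
    exact mul_le_mul_of_nonneg_right (hC z) (by positivity)
  exists_compact := ⟨tsupport a, hc.isCompact, fun z hz w => by
    rw [image_eq_zero_of_notMem_tsupport hz, zero_mul]⟩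

/-- By Cauchy–Schwarz the inner product absorbs one power of `‖w‖⁻¹`, leaving a singularity of order
`p`, locally integrable in dimension three. -/
lemma WeakKernel.of_vector {U : R3 → R3} (hU : Continuous U) (hc : HasCompactSupport U)
    {p : ℕ} (hp : p < 3) : WeakKernel fun z w => inner ℝ (U z) w * ‖w‖⁻¹ ^ (p + 1) where
  measurable := by
    have := hU.measurable
    have h1 : Measurable fun q : R3 × R3 => inner ℝ (U q.1) q.2 :=
      (this.comp measurable_fst).inner measurable_snd
    exact h1.mul ((measurable_snd.norm.inv).pow_const _)
  continuous_left w := by fun_prop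
  exists_bound := by
    obtain ⟨C, hC⟩ := hc.exists_bound_of_continuous hU
    refine ⟨fun w => C * ‖w‖⁻¹ ^ p, locallyIntegrable_inv_norm_pow C hp, fun z w => ?_⟩
    rw [abs_mul, abs_pow, abs_inv, abs_norm]
    have hC0 : 0 ≤ C := (norm_nonneg _).trans (hC z)
    by_cases hw : w = 0
    · simp only [hw, inner_zero_right, abs_zero, zero_mul]; positivity
    · have hw' : 0 < ‖w‖ := norm_pos_iff.2 hw
      calc |inner ℝ (U z) w| * ‖w‖⁻¹ ^ (p + 1) ≤ (C * ‖w‖) * ‖w‖⁻¹ ^ (p + 1) := by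
            refine mul_le_mul_of_nonneg_right ?_ (by positivity)
            exact (abs_real_inner_le_norm _ _).trans (by gcongr; exact hC z)
        _ = C * ‖w‖⁻¹ ^ p := by
            linear_combination (C * ‖w‖⁻¹ ^ p) * mul_inv_cancel₀ hw'.ne'
  exists_compact := ⟨tsupport U, hc.isCompact, fun z hz w => by
    rw [image_eq_zero_of_notMem_tsupport hz, inner_zero_left, zero_mul]⟩

/-- This removes the factor `1 / |z - x|`: the perturbations vanish near a detector. -/
lemma continuous_mul_inv_norm_smul {E : Type*} [NormedAddCommGroup E] [NormedSpace ℝ E]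
    {φ : R3 → E} (hφ : Continuous φ) {x : R3} (hx : x ∉ tsupport φ) (C : ℝ) :
    Continuous fun z => (C * ‖z - x‖⁻¹) • φ z := by
  rw [continuous_iff_continuousAt]
  intro z
  by_cases h : z = x
  · subst h
    refine (continuousAt_const (y := (0 : E))).congr ?_
    filter_upwards [notMem_tsupport_iff_eventuallyEq.1 hx] with w hw
    rw [hw]; simp
  · have : ‖z - x‖ ≠ 0 := norm_ne_zero_iff.2 (sub_ne_zero.2 h)
    fun_prop (disch := assumption)

lemma hasCompactSupport_mul_inv_norm_smul {E : Type*} [NormedAddCommGroup E] [NormedSpace ℝ E]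
    {φ : R3 → E} (hφ : HasCompactSupport φ) (x : R3) (C : ℝ) :
    HasCompactSupport fun z => (C * ‖z - x‖⁻¹) • φ z :=
  HasCompactSupport.intro hφ.isCompact fun z hz => by
    rw [image_eq_zero_of_notMem_tsupport hz, smul_zero]

/-! ### The measured kernel and its Radon inversion -/

namespace Specimen

variable {D : Set R3} {S : Specimen}

/-- The kernel of the second term of `Specimen.kernel`. -/
def κ₀ (S : Specimen) (x z w : R3) : ℝ :=
  (S.ε / (16 * Real.pi ^ 2) * ‖z - x‖⁻¹) • S.α₁ z * ‖w‖⁻¹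

/-- The kernel of the third term of `Specimen.kernel`. -/
def κ₁ (S : Specimen) (x z w : R3) : ℝ :=
  inner ℝ ((S.ε / (16 * Real.pi ^ 2) * ‖z - x‖⁻¹) • gradient S.ρ₁ z) w * ‖w‖⁻¹ ^ (1 + 1)

/-- The kernel of the fourth term of `Specimen.kernel`. -/
def κ₂ (S : Specimen) (x z w : R3) : ℝ :=
  inner ℝ ((S.ε / (32 * Real.pi ^ 2) * ‖z - x‖⁻¹) • gradient S.ρ₁ z) w * ‖w‖⁻¹ ^ (2 + 1)

lemma Admissible.notMem_tsupport (hS : S.Admissible D) {x : R3} (hx : x ∈ D) : x ∉ tsupport S.f :=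
  fun h => (hS.encloses x h).1 hx

lemma Admissible.perturbed_subset (hS : S.Admissible D) : S.perturbed ⊆ tsupport S.f :=
  hS.perturbed_ssubset.subset.trans interior_subset

lemma Admissible.hasCompactSupport_α₁ (hS : S.Admissible D) : HasCompactSupport S.α₁ :=
  hS.hasCompactSupport_f.of_isClosed_subset (isClosed_tsupport _)
    (Set.subset_union_left.trans hS.perturbed_subset)

lemma Admissible.hasCompactSupport_ρ₁ (hS : S.Admissible D) : HasCompactSupport S.ρ₁ :=
  hS.hasCompactSupport_f.of_isClosed_subset (isClosed_tsupport _)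
    (Set.subset_union_right.trans hS.perturbed_subset)

lemma tsupport_gradient_subset (ρ : R3 → ℝ) : tsupport (gradient ρ) ⊆ tsupport ρ := by
  refine closure_minimal (fun z hz => ?_) (isClosed_tsupport _)
  by_contra h
  refine hz ?_
  rw [gradient, image_eq_zero_of_notMem_tsupport (fun h' => h (tsupport_fderiv_subset ℝ h')),
    map_zero]

lemma continuous_gradient {ρ : R3 → ℝ} (hρ : ContDiff ℝ 1 ρ) : Continuous (gradient ρ) :=
  (InnerProductSpace.toDual ℝ R3).symm.continuous.comp (hρ.continuous_fderiv (by norm_num))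

lemma Admissible.notMem_tsupport_α₁ (hS : S.Admissible D) {x : R3} (hx : x ∈ D) :
    x ∉ tsupport S.α₁ := fun h => hS.notMem_tsupport hx (hS.perturbed_subset (Or.inl h))

lemma Admissible.notMem_tsupport_gradient (hS : S.Admissible D) {x : R3} (hx : x ∈ D) :
    x ∉ tsupport (gradient S.ρ₁) := fun h =>
  hS.notMem_tsupport hx (hS.perturbed_subset (Or.inr (tsupport_gradient_subset _ h)))

lemma Admissible.hasCompactSupport_gradient (hS : S.Admissible D) :
    HasCompactSupport (gradient S.ρ₁) :=
  hS.hasCompactSupport_ρ₁.of_isClosed_subset (isClosed_tsupport _) (tsupport_gradient_subset _)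

lemma Admissible.weakKernel_κ₀ (hS : S.Admissible D) {x : R3} (hx : x ∈ D) :
    WeakKernel (S.κ₀ x) := by
  have h1 := continuous_mul_inv_norm_smul hS.contDiff_α₁.continuous (hS.notMem_tsupport_α₁ hx)
    (S.ε / (16 * Real.pi ^ 2))
  have h2 := hasCompactSupport_mul_inv_norm_smul hS.hasCompactSupport_α₁ x
    (S.ε / (16 * Real.pi ^ 2))
  exact WeakKernel.of_scalar h1 h2

lemma Admissible.weakKernel_κ₁ (hS : S.Admissible D) {x : R3} (hx : x ∈ D) :
    WeakKernel (S.κ₁ x) := by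
  have h1 := continuous_mul_inv_norm_smul (continuous_gradient hS.contDiff_ρ₁)
    (hS.notMem_tsupport_gradient hx) (S.ε / (16 * Real.pi ^ 2))
  have h2 := hasCompactSupport_mul_inv_norm_smul hS.hasCompactSupport_gradient x
    (S.ε / (16 * Real.pi ^ 2))
  exact WeakKernel.of_vector h1 h2 (p := 1) (by norm_num)

lemma Admissible.weakKernel_κ₂ (hS : S.Admissible D) {x : R3} (hx : x ∈ D) :
    WeakKernel (S.κ₂ x) := by
  have h1 := continuous_mul_inv_norm_smul (continuous_gradient hS.contDiff_ρ₁)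
    (hS.notMem_tsupport_gradient hx) (S.ε / (32 * Real.pi ^ 2))
  have h2 := hasCompactSupport_mul_inv_norm_smul hS.hasCompactSupport_gradient x
    (S.ε / (32 * Real.pi ^ 2))
  exact WeakKernel.of_vector h1 h2 (p := 2) (by norm_num)

/-- Before the arrival time the spheroid is empty and the truncated square is zero, so one formula
holds for all times and can be studied term by term. -/
lemma kernel_eq (S : Specimen) (t : ℝ) (x y : R3) :
    S.kernel t x y = max (t - ‖y - x‖) 0 ^ 2 / (8 * Real.pi * ‖y - x‖) * (1 - S.ε * S.α₁ y)
      + spheroidMoment (fun z => S.κ₀ x z (z - y)) x y 0 t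
      + spheroidMoment (fun z => S.κ₁ x z (z - y)) x y 1 t
      + spheroidMoment (fun z => S.κ₂ x z (z - y)) x y 2 t := by
  unfold kernel
  split_ifs with h
  · rw [max_eq_left (by linarith)]
    unfold spheroidMoment κ₀ κ₁ κ₂
    simp only [inner_smul_left, inner_smul_right, smul_eq_mul, conj_trivial]
    congr 2
    · congr 2
      ext z; ring
    · congr 1
      ext z; ring
    · ext z; ring
  · rw [max_eq_right (by linarith)]
    unfold spheroidMoment
    rw [spheroid_eq_empty (not_le.1 h)]
    simp

/-- The only singularity in `y` is `1 / |y - x|` in the first term, and `f` vanishes near `x`. -/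
lemma Admissible.continuous_kernel_mul (hS : S.Admissible D) {x : R3} (hx : x ∈ D) (t : ℝ) :
    Continuous fun y => S.kernel t x y * S.f y := by
  simp_rw [kernel_eq]
  have h0 := (hS.weakKernel_κ₀ hx).continuous_setIntegral 0 t x
  have h1 := (hS.weakKernel_κ₁ hx).continuous_setIntegral 1 t x
  have h2 := (hS.weakKernel_κ₂ hx).continuous_setIntegral 2 t x
  have hf := hS.continuous_f
  have hα := hS.contDiff_α₁.continuous
  rw [continuous_iff_continuousAt]
  intro y
  by_cases h : y = x
  · subst h
    refine (continuousAt_const (y := (0 : ℝ))).congr ?_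
    filter_upwards [notMem_tsupport_iff_eventuallyEq.1 (hS.notMem_tsupport hx)] with w hw
    rw [hw]; simp
  · have h' : ‖y - x‖ ≠ 0 := norm_ne_zero_iff.2 (sub_ne_zero.2 h)
    have h3 : 8 * Real.pi * ‖y - x‖ ≠ 0 := by positivity
    refine ContinuousAt.mul (((ContinuousAt.add ?_ h0.continuousAt).add h1.continuousAt).add
      h2.continuousAt) hf.continuousAt
    fun_prop (disch := assumption)

lemma Admissible.inverted_eq (hS : S.Admissible D) {x : R3} (hx : x ∈ D) (y : R3) :
    S.inverted x y = fun t => S.kernel t x y * S.f y := by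
  ext t
  exact congrFun (radonInv_radon (hS.continuous_kernel_mul hx t)
    (hS.hasCompactSupport_f.mul_left)) y

end Specimen

/-! ### Large-time and first-arrival asymptotics -/

lemma eventually_quadratic {F : ℝ → ℝ} {a b d : ℝ}
    (hF : ∀ᶠ t in atTop, F t = a * t ^ 2 + b * t + d) :
    (∀ᶠ t in atTop, ContDiffAt ℝ 2 F t) ∧ (∀ᶠ t in atTop, deriv F t = 2 * a * t + b) ∧
      ∀ᶠ t in atTop, deriv (deriv F) t = 2 * a := by
  obtain ⟨T, hT⟩ := eventually_atTop.1 hF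
  have h0 : ∀ t > T, F =ᶠ[𝓝 t] fun t => a * t ^ 2 + b * t + d := fun t ht => by
    filter_upwards [lt_mem_nhds ht] with s hs using hT s hs.le
  have h1 : ∀ t > T, deriv F t = 2 * a * t + b := fun t ht => by
    rw [(h0 t ht).deriv_eq]
    have : HasDerivAt (fun t : ℝ => a * t ^ 2 + b * t + d) (a * (2 * t) + b * 1) t := by
      have h := (((hasDerivAt_id t).pow 2).const_mul a).add ((hasDerivAt_id t).const_mul b)
      simpa using h.add_const d
    rw [this.deriv]; ring
  refine ⟨?_, ?_, ?_⟩
  · filter_upwards [eventually_gt_atTop T] with t ht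
    exact ContDiffAt.congr_of_eventuallyEq (by fun_prop) (h0 t ht)
  · filter_upwards [eventually_gt_atTop T] with t ht using h1 t ht
  · filter_upwards [eventually_gt_atTop T] with t ht
    have : deriv F =ᶠ[𝓝 t] fun t => 2 * a * t + b := by
      filter_upwards [lt_mem_nhds ht] with s hs using h1 s hs
    rw [this.deriv_eq]
    have : HasDerivAt (fun t : ℝ => 2 * a * t + b) (2 * a * 1) t := by
      simpa using ((hasDerivAt_id t).const_mul (2 * a)).add_const b
    rw [this.deriv]; ring

lemma integrable_continuous_mul {Ψ : R3 → ℝ} (hΨ : Integrable Ψ) (hc : HasCompactSupport Ψ)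
    {g : R3 → ℝ} (hg : Continuous g) : Integrable fun z => g z * Ψ z := by
  refine (integrableOn_iff_integrable_of_support_subset (s := tsupport Ψ) ?_).1 ?_
  · exact (Function.support_mul_subset_right _ _).trans (subset_tsupport _)
  · exact (hΨ.integrableOn (s := tsupport Ψ)).continuousOn_mul hg.continuousOn hc.isCompact

namespace Specimen

variable {D : Set R3} {S : Specimen}

/-- The data exist and have the asserted values as soon as the quantity that is differentiated has
the corresponding one-sided derivative and is eventually quadratic. -/
lemma dataExist_of {x y : R3} {h' : ℝ → ℝ} {L a b d : ℝ}
    (hd : ∀ t > ‖y - x‖, HasDerivAt (S.inverted x y) (h' t) t)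
    (hL : Tendsto h' (𝓝[>] ‖y - x‖) (𝓝 L))
    (hq : ∀ᶠ t in atTop, S.inverted x y t = a * t ^ 2 + b * t + d) :
    S.DataExist x y ∧ S.M0 x y = L ∧ S.Ninf x y = -b := by
  obtain ⟨q1, q2, q3⟩ := eventually_quadratic hq
  have e1 : Tendsto (fun t => deriv (S.inverted x y) t) (𝓝[>] ‖y - x‖) (𝓝 L) := by
    refine hL.congr' ?_
    filter_upwards [self_mem_nhdsWithin] with t ht using ((hd t ht).deriv).symm
  have e2 : Tendsto (fun t => deriv (deriv (S.inverted x y)) t) atTop (𝓝 (2 * a)) :=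
    tendsto_const_nhds.congr' (q3.mono fun t ht => ht.symm)
  have m0 : S.M0 x y = L := e1.limUnder_eq
  have m1 : S.Minf x y = 2 * a := e2.limUnder_eq
  have e3 : Tendsto (fun t => S.Minf x y * t - deriv (S.inverted x y) t) atTop (𝓝 (-b)) := by
    refine tendsto_const_nhds.congr' (q2.mono fun t ht => ?_)
    change -b = S.Minf x y * t - deriv (S.inverted x y) t
    rw [ht, m1]; ring
  have m2 : S.Ninf x y = -b := e3.limUnder_eq
  refine ⟨⟨?_, m0 ▸ e1, q1, m1 ▸ e2, m2 ▸ e3⟩, m0, m2⟩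
  filter_upwards [self_mem_nhdsWithin] with t ht using (hd t ht).differentiableAt

/-- The linear coefficient of the kernel for large times. -/
def linearCoeff (S : Specimen) (x y : R3) : ℝ :=
  -(1 - S.ε * S.α₁ y) / (4 * Real.pi) + (∫ z, S.κ₁ x z (z - y))
    - 2 * ∫ z, (‖z - x‖ + ‖z - y‖) * S.κ₂ x z (z - y)

/-- Once the spheroid contains the supports, the moments are integrals over all of space of powers
of `t - (|z - x| + |z - y|)`, which are expanded in `t`. -/
lemma Admissible.kernel_eventually_quadratic (hS : S.Admissible D) {x y : R3} (hx : x ∈ D)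
    (hxy : y ≠ x) : ∃ a d : ℝ, ∀ᶠ t in atTop,
      S.kernel t x y = a * t ^ 2 + S.linearCoeff x y * t + d := by
  have hc : ‖y - x‖ ≠ 0 := norm_ne_zero_iff.2 (sub_ne_zero.2 hxy)
  have w1 := hS.weakKernel_κ₁ hx
  have w2 := hS.weakKernel_κ₂ hx
  have hs : Continuous fun z : R3 => ‖z - x‖ + ‖z - y‖ := by fun_prop
  have i1 := w1.integrable y
  have i1' := integrable_continuous_mul i1 (w1.hasCompactSupport y) hs
  have i2 := w2.integrable y
  have i2' := integrable_continuous_mul i2 (w2.hasCompactSupport y) hs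
  have i2'' : Integrable fun z => (‖z - x‖ + ‖z - y‖) ^ 2 * S.κ₂ x z (z - y) :=
    integrable_continuous_mul i2 (w2.hasCompactSupport y) (hs.pow 2)
  have i2d : ∀ t : ℝ, Integrable fun z => t ^ 2 * S.κ₂ x z (z - y) -
      2 * t * ((‖z - x‖ + ‖z - y‖) * S.κ₂ x z (z - y)) := fun t =>
    (i2.const_mul _).sub (i2'.const_mul _)
  refine ⟨(1 - S.ε * S.α₁ y) / (8 * Real.pi * ‖y - x‖) + ∫ z, S.κ₂ x z (z - y),
    ‖y - x‖ * (1 - S.ε * S.α₁ y) / (8 * Real.pi) + (∫ z, S.κ₀ x z (z - y))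
      - (∫ z, (‖z - x‖ + ‖z - y‖) * S.κ₁ x z (z - y))
      + ∫ z, (‖z - x‖ + ‖z - y‖) ^ 2 * S.κ₂ x z (z - y), ?_⟩
  filter_upwards [spheroidMoment_eq_integral ((hS.weakKernel_κ₀ hx).hasCompactSupport y) x y,
    spheroidMoment_eq_integral (w1.hasCompactSupport y) x y,
    spheroidMoment_eq_integral (w2.hasCompactSupport y) x y,
    eventually_ge_atTop ‖y - x‖] with t h0 h1 h2 ht
  rw [kernel_eq, h0, h1, h2, max_eq_left (by linarith)]
  have m1 : ∫ z, (t - ‖z - x‖ - ‖z - y‖) ^ 1 * S.κ₁ x z (z - y) =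
      t * (∫ z, S.κ₁ x z (z - y)) - ∫ z, (‖z - x‖ + ‖z - y‖) * S.κ₁ x z (z - y) := by
    rw [← integral_const_mul, ← integral_sub (i1.const_mul t) i1']
    congr 1; ext z; ring
  have m2 : ∫ z, (t - ‖z - x‖ - ‖z - y‖) ^ 2 * S.κ₂ x z (z - y) =
      t ^ 2 * (∫ z, S.κ₂ x z (z - y))
        - 2 * t * (∫ z, (‖z - x‖ + ‖z - y‖) * S.κ₂ x z (z - y))
        + ∫ z, (‖z - x‖ + ‖z - y‖) ^ 2 * S.κ₂ x z (z - y) := by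
    rw [← integral_const_mul, ← integral_const_mul, ← integral_sub (i2.const_mul _)
      (i2'.const_mul _), ← integral_add (i2d t) i2'']
    congr 1; ext z; ring
  rw [m1, m2]
  simp only [pow_zero, one_mul, linearCoeff]
  field_simp
  ring

/-- The kernel is differentiable after the first arrival, and its derivative has a limit there. -/
lemma Admissible.hasDerivAt_kernel (hS : S.Admissible D) {x y : R3} (hx : x ∈ D) (hxy : y ≠ x) :
    ∃ h' : ℝ → ℝ, (∀ t > ‖y - x‖, HasDerivAt (fun t => S.kernel t x y) (h' t) t) ∧
      Tendsto h' (𝓝[>] ‖y - x‖) (𝓝 (1 / (8 * Real.pi * ‖y - x‖) *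
        ∫ r in (0 : ℝ)..‖y - x‖, S.ε * S.α₁ (x + r • (‖y - x‖⁻¹ • (y - x))))) := by
  have hc : ‖y - x‖ ≠ 0 := norm_ne_zero_iff.2 (sub_ne_zero.2 hxy)
  have i1 := (hS.weakKernel_κ₁ hx).integrable y
  have i2 := (hS.weakKernel_κ₂ hx).integrable y
  have hα := hS.contDiff_α₁.continuous
  obtain ⟨G, hG, hGc, hGt⟩ := exists_confocal_density
    (α := fun z => S.ε / (16 * Real.pi ^ 2) * S.α₁ z) (by fun_prop) hxy
  have hm0 : ∀ t, ‖y - x‖ ≤ t → spheroidMoment (fun z => S.κ₀ x z (z - y)) x y 0 t =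
      ∫ s in ‖y - x‖..t, G s := by
    intro t ht
    rw [← hGt t ht, spheroidMoment]
    congr 1; ext z
    simp only [κ₀, pow_zero, one_mul, smul_eq_mul]
    ring
  refine ⟨fun t => 2 * (t - ‖y - x‖) / (8 * Real.pi * ‖y - x‖) * (1 - S.ε * S.α₁ y) + G t
    + ((0 : ℕ) + 1) * spheroidMoment (fun z => S.κ₁ x z (z - y)) x y 0 t
    + ((1 : ℕ) + 1) * spheroidMoment (fun z => S.κ₂ x z (z - y)) x y 1 t, fun t ht => ?_, ?_⟩
  · have e : (fun t => S.kernel t x y) =ᶠ[𝓝 t] fun t =>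
        (t - ‖y - x‖) ^ 2 / (8 * Real.pi * ‖y - x‖) * (1 - S.ε * S.α₁ y)
        + (∫ s in ‖y - x‖..t, G s)
        + spheroidMoment (fun z => S.κ₁ x z (z - y)) x y 1 t
        + spheroidMoment (fun z => S.κ₂ x z (z - y)) x y 2 t := by
      filter_upwards [lt_mem_nhds ht] with s hs
      rw [kernel_eq, max_eq_left (by linarith), hm0 s hs.le]
    refine HasDerivAt.congr_of_eventuallyEq ?_ e
    refine HasDerivAt.add (HasDerivAt.add (HasDerivAt.add ?_ ?_) ?_) ?_
    · have h := ((((hasDerivAt_id t).sub_const ‖y - x‖).pow 2).div_const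
        (8 * Real.pi * ‖y - x‖)).mul_const (1 - S.ε * S.α₁ y)
      simpa using h
    · exact (hG.integral_hasStrictDerivAt _ t).hasDerivAt
    · exact hasDerivAt_spheroidMoment i1 x y 0 t
    · exact hasDerivAt_spheroidMoment i2 x y 1 t
  · have c1 := continuous_spheroidMoment i1 x y 0
    have c2 := continuous_spheroidMoment i2 x y 1
    -- The candidate derivative is continuous on the whole line, so its limit is its value at the
    -- arrival time. There both moments vanish and only `G` survives, with `2π / (16π²) = 1 / (8π)`.
    refine Tendsto.mono_left ?_ nhdsWithin_le_nhds
    refine (Continuous.tendsto' ?_ _ _ ?_)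
    · fun_prop
    · rw [spheroidMoment_degenerate, spheroidMoment_degenerate, hGc]
      simp only [intervalIntegral.integral_const_mul]
      field_simp
      ring

lemma Admissible.data_of_ne_zero (hS : S.Admissible D) {x y : R3} (hx : x ∈ D) (hy : S.f y ≠ 0) :
    S.DataExist x y ∧
      S.M0 x y = (1 / (8 * Real.pi * ‖y - x‖) *
        ∫ r in (0 : ℝ)..‖y - x‖, S.ε * S.α₁ (x + r • (‖y - x‖⁻¹ • (y - x)))) * S.f y ∧
      S.Ninf x y = -(S.linearCoeff x y * S.f y) := by
  have hxy : y ≠ x := by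
    rintro rfl
    exact hy (image_eq_zero_of_notMem_tsupport (hS.notMem_tsupport hx))
  obtain ⟨h', hd, hL⟩ := hS.hasDerivAt_kernel hx hxy
  obtain ⟨a, d, hq⟩ := hS.kernel_eventually_quadratic hx hxy
  have hi := hS.inverted_eq hx y
  refine dataExist_of (h' := fun t => h' t * S.f y) (a := a * S.f y) (d := d * S.f y)
    (fun t ht => ?_) (hL.mul_const _) ?_
  · rw [hi]; exact (hd t ht).mul_const _
  · rw [hi]
    filter_upwards [hq] with t ht
    rw [ht]; ring

lemma Admissible.dataExist (hS : S.Admissible D) {x : R3} (hx : x ∈ D) (y : R3) :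
    S.DataExist x y := by
  by_cases hy : S.f y = 0
  · have hi : S.inverted x y = fun _ => 0 := by
      rw [hS.inverted_eq hx y]; simp [hy]
    refine (dataExist_of (h' := fun _ => 0) (L := 0) (a := 0) (b := 0) (d := 0)
      (fun t _ => ?_) tendsto_const_nhds ?_).1
    · rw [hi]; exact hasDerivAt_const _ _
    · rw [hi]; simp
  · exact (hS.data_of_ne_zero hx hy).1

/-- In the combination of `κ₁` and `κ₂` the terms with `1 / (|z - x| |z - y|)` cancel. The rest is
independent of the detector: it is the Newtonian flux of `∇ρ₁`, which is zero here. -/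
lemma Admissible.Ninf_eq (hS : S.Admissible D) {x y : R3} (hx : x ∈ D) (hy : S.f y ≠ 0)
    (hyp : y ∉ S.perturbed) : S.f y = 4 * Real.pi * S.Ninf x y := by
  have hα : S.α₁ y = 0 := image_eq_zero_of_notMem_tsupport fun h => hyp (Or.inl h)
  have hρ : y ∉ tsupport S.ρ₁ := fun h => hyp (Or.inr h)
  have w1 := hS.weakKernel_κ₁ hx
  have w2 := hS.weakKernel_κ₂ hx
  have i1 := w1.integrable y
  have i2' := integrable_continuous_mul (w2.integrable y) (w2.hasCompactSupport y)
    (by fun_prop : Continuous fun z : R3 => ‖z - x‖ + ‖z - y‖)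
  have hflux : 2 * (∫ z, (‖z - x‖ + ‖z - y‖) * S.κ₂ x z (z - y)) -
      (∫ z, S.κ₁ x z (z - y)) = 0 := by
    rw [← integral_const_mul, ← integral_sub (i2'.const_mul 2) i1]
    have h0 := integral_gradient_newton hS.contDiff_ρ₁ hS.hasCompactSupport_ρ₁ hρ
    refine Eq.trans ?_ ((integral_const_mul (S.ε / (16 * Real.pi ^ 2)) _).trans
      ((congrArg _ h0).trans (mul_zero _)))
    congr 1; ext z
    simp only [κ₁, κ₂, inner_smul_left, conj_trivial]
    by_cases hz : z = x
    · have : gradient S.ρ₁ z = 0 :=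
        image_eq_zero_of_notMem_tsupport (hz ▸ hS.notMem_tsupport_gradient hx)
      simp [this]
    by_cases hzy : z = y
    · simp [hzy]
    have h1 : ‖z - x‖ ≠ 0 := norm_ne_zero_iff.2 (sub_ne_zero.2 hz)
    have h2 : ‖z - y‖ ≠ 0 := norm_ne_zero_iff.2 (sub_ne_zero.2 hzy)
    simp only [inv_pow]
    field_simp
    ring
  rw [(hS.data_of_ne_zero hx hy).2.2, linearCoeff, hα]
  have : (∫ z, S.κ₁ x z (z - y)) = 2 * ∫ z, (‖z - x‖ + ‖z - y‖) * S.κ₂ x z (z - y) := by linarith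
  rw [this]
  field_simp
  ring

end Specimen

/-! ### Geometry of detector pairs and lines -/

/-- A ray emanating from an enclosed point meets the enclosing set. -/
lemma Encloses.exists_mem_ray {D A : Set R3} (h : Encloses D A) {p v : R3} (hp : p ∈ A)
    (hv : ‖v‖ = 1) : ∃ s : ℝ, 0 ≤ s ∧ p + s • v ∈ D := by
  by_contra! hcon
  have hpre : IsPreconnected ((fun s : ℝ => p + s • v) '' Set.Ici 0) :=
    isPreconnected_Ici.image _ (by fun_prop)
  have hsub : (fun s : ℝ => p + s • v) '' Set.Ici 0 ⊆ connectedComponentIn Dᶜ p := by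
    refine hpre.subset_connectedComponentIn ⟨0, by simp, by simp⟩ ?_
    rintro _ ⟨s, hs, rfl⟩
    exact hcon s hs
  obtain ⟨C, hC⟩ := ((h p hp).2.subset hsub).exists_norm_le
  have h1 := hC (p + (|C| + ‖p‖ + 1) • v) ⟨|C| + ‖p‖ + 1, by simp; positivity, rfl⟩
  have h2 : ‖(|C| + ‖p‖ + 1) • v‖ = |C| + ‖p‖ + 1 := by
    rw [norm_smul, hv, mul_one, Real.norm_of_nonneg (by positivity)]
  have h3 := norm_sub_le (p + (|C| + ‖p‖ + 1) • v) p
  rw [add_sub_cancel_left, h2] at h3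
  linarith [le_abs_self C]

lemma isCompact_line_preimage {K : Set R3} (hK : IsCompact K) (y : R3) {v : R3} (hv : ‖v‖ = 1) :
    IsCompact {s : ℝ | y + s • v ∈ K} := by
  have hv0 : v ≠ 0 := by rintro rfl; simp at hv
  have : IsClosedEmbedding fun s : ℝ => y + s • v :=
    (Homeomorph.addLeft y).isClosedEmbedding.comp (isClosedEmbedding_smul_left hv0)
  exact this.isCompact_preimage hK

/-- The extreme point of a compact set on a ray from an enclosed point lies beyond all points of
enclosed sets on the line. -/
lemma exists_extreme_detector {D : Set R3} (hD : IsCompact D) {A B : Set R3} (hA : Encloses D A)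
    (hB : Encloses D B) {y v : R3} (hy : y ∈ A) (hv : ‖v‖ = 1) :
    ∃ b : ℝ, 0 ≤ b ∧ y + b • v ∈ D ∧ ∀ s : ℝ, y + s • v ∈ A ∪ B → s ≤ b := by
  obtain ⟨s₀, hs₀, hs₀D⟩ := hA.exists_mem_ray hy hv
  obtain ⟨b, hb, hbm⟩ := (isCompact_line_preimage hD y hv).exists_isMaxOn ⟨s₀, hs₀D⟩
    (continuous_id.continuousOn)
  refine ⟨b, hs₀.trans (hbm hs₀D), hb, fun s hs => ?_⟩
  -- Any enclosed point has a point of `D` ahead of it, and the maximal parameter `b` is at least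
  -- that far.
  obtain ⟨r, hr, hrD⟩ : ∃ r : ℝ, 0 ≤ r ∧ y + s • v + r • v ∈ D := by
    rcases hs with hs | hs
    · exact hA.exists_mem_ray hs hv
    · exact hB.exists_mem_ray hs hv
  rw [add_assoc, ← add_smul] at hrD
  have : s + r ≤ b := hbm hrD
  linarith

/-- Two enclosed supports have common detector pairs. -/
lemma exists_common_detectorPair {D : Set R3} (hD : IsCompact D) {S S' : Specimen}
    (hS : S.Admissible D) (hS' : S'.Admissible D) {y v : R3} (hy : y ∈ tsupport S.f)
    (hv : ‖v‖ = 1) : ∃ x x' : R3, IsDetectorPair D S y v x x' ∧ IsDetectorPair D S' y v x x' := by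
  obtain ⟨b, hb0, hbD, hb⟩ := exists_extreme_detector hD hS.encloses hS'.encloses hy hv
  obtain ⟨a, ha0, haD, ha⟩ := exists_extreme_detector hD hS.encloses hS'.encloses hy
    (v := -v) (by rwa [norm_neg])
  have haD' : y - a • v ∈ D := by simpa [sub_eq_add_neg] using haD
  have hs : ∀ s : ℝ, y + s • v ∈ tsupport S.f ∪ tsupport S'.f → -a ≤ s ∧ s ≤ b := by
    intro s hs
    refine ⟨?_, hb s hs⟩
    have := ha (-s) (by simpa using hs)
    linarith
  exact ⟨y - a • v, y + b • v,
    ⟨haD', hbD, a, b, ha0, hb0, rfl, rfl, fun s h => hs s (Or.inl h)⟩,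
    ⟨haD', hbD, a, b, ha0, hb0, rfl, rfl, fun s h => hs s (Or.inr h)⟩⟩

lemma xray_add_smul (φ : R3 → ℝ) (y v : R3) (s : ℝ) : xray φ (y + s • v) v = xray φ y v := by
  unfold xray
  rw [← integral_add_left_eq_self (fun r : ℝ => φ (y + r • v)) s]
  simp_rw [add_smul, add_assoc]

/-- The last point of a nonempty compact set on a line. -/
lemma exists_last_point {K : Set R3} (hK : IsCompact K) {y v : R3} (hv : ‖v‖ = 1)
    (h : ∃ s : ℝ, y + s • v ∈ K) :
    ∃ s : ℝ, y + s • v ∈ K ∧ y + s • v ∉ interior K := by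
  obtain ⟨s, hs, hm⟩ := (isCompact_line_preimage hK y hv).exists_isMaxOn h continuous_id.continuousOn
  refine ⟨s, hs, fun hi => ?_⟩
  have hcont : ContinuousAt (fun r : ℝ => y + r • v) s := by fun_prop
  have hev := hcont.eventually_mem (mem_interior_iff_mem_nhds.1 hi)
  obtain ⟨r, hr, hrs⟩ := ((hev.filter_mono nhdsWithin_le_nhds).and
      (self_mem_nhdsWithin : Set.Ioi s ∈ 𝓝[>] s)).exists
  exact absurd (hm hr) (not_le.2 hrs)

/-- The X-ray transform of a continuous compactly supported function is continuous in the base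
point. -/
lemma continuous_xray {φ : R3 → ℝ} (hφ : Continuous φ) (hc : HasCompactSupport φ) {v : R3}
    (hv : ‖v‖ = 1) : Continuous fun y => xray φ y v := by
  rw [continuous_iff_continuousAt]
  intro y
  obtain ⟨R, hR⟩ := hc.isCompact.isBounded.exists_norm_le
  obtain ⟨C, hC⟩ := hc.exists_bound_of_continuous hφ
  refine continuousAt_of_dominated
    (bound := (Set.Icc (-(R + ‖y‖ + 1)) (R + ‖y‖ + 1)).indicator fun _ => C) ?_ ?_ ?_ ?_
  · exact Eventually.of_forall fun y' => Continuous.aestronglyMeasurable (by fun_prop)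
  · filter_upwards [Metric.ball_mem_nhds y one_pos] with y' hy'
    refine Eventually.of_forall fun s => ?_
    by_cases hs : s ∈ Set.Icc (-(R + ‖y‖ + 1)) (R + ‖y‖ + 1)
    · rw [Set.indicator_of_mem hs]; exact hC _
    · rw [Set.indicator_of_notMem hs]
      by_contra hne
      have hmem : y' + s • v ∈ tsupport φ := by
        by_contra h
        rw [image_eq_zero_of_notMem_tsupport h, norm_zero] at hne
        exact hne le_rfl
      refine hs (abs_le.1 ?_)
      have h1 := hR _ hmem
      have h2 := norm_sub_le (y' + s • v) y'
      rw [add_sub_cancel_left, norm_smul, hv, mul_one, Real.norm_eq_abs] at h2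
      have h3 := norm_sub_norm_le y' y
      rw [← dist_eq_norm] at h3
      have h4 : dist y' y < 1 := hy'
      linarith
  · rw [integrable_indicator_iff measurableSet_Icc]
    exact integrableOn_const (by simp)
  · exact Eventually.of_forall fun s => by fun_prop

/-! ### Recovery and uniqueness of the X-ray transform -/

namespace Specimen

variable {D : Set R3} {S S' : Specimen}

lemma Admissible.α₁_eq_zero (hS : S.Admissible D) {z : R3} (hz : z ∉ tsupport S.f) : S.α₁ z = 0 :=
  image_eq_zero_of_notMem_tsupport fun h => hz (hS.perturbed_subset (Or.inl h))

lemma Admissible.xray_eq_zero (hS : S.Admissible D) {y v : R3}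
    (h : ∀ s : ℝ, y + s • v ∉ tsupport S.f) : xray (fun z => S.ε * S.α₁ z) y v = 0 := by
  unfold xray
  simp [fun s => hS.α₁_eq_zero (h s)]

lemma Admissible.continuous_xray (hS : S.Admissible D) {v : R3} (hv : ‖v‖ = 1) :
    Continuous fun y => xray (fun z => S.ε * S.α₁ z) y v :=
  _root_.continuous_xray (hS.contDiff_α₁.continuous.const_smul S.ε)
    (hS.hasCompactSupport_α₁.mul_left) hv

/-- The data at one detector give the integral over the segment from the detector. -/
lemma Admissible.M0_mul_norm (hS : S.Admissible D) {y v : R3} {a : ℝ} (hv : ‖v‖ = 1) (ha : 0 ≤ a)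
    (hx : y - a • v ∈ D) (hy : S.f y ≠ 0) :
    8 * Real.pi * (S.M0 (y - a • v) y * ‖y - (y - a • v)‖) =
      (∫ s in (-a)..0, S.ε * S.α₁ (y + s • v)) * S.f y := by
  have hn : ‖y - (y - a • v)‖ = a := by
    rw [sub_sub_cancel, norm_smul, hv, mul_one, Real.norm_of_nonneg ha]
  have ha0 : a ≠ 0 := by
    rintro rfl
    simp only [zero_smul, sub_zero] at hx
    exact hy (image_eq_zero_of_notMem_tsupport (hS.notMem_tsupport hx))
  rw [(hS.data_of_ne_zero hx hy).2.1, hn, sub_sub_cancel, smul_smul, inv_mul_cancel₀ ha0, one_smul]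
  have h := intervalIntegral.integral_comp_sub_right (a := 0) (b := a)
    (fun s : ℝ => S.ε * S.α₁ (y + s • v)) a
  rw [zero_sub, sub_self] at h
  rw [← h]
  have e : ∀ r : ℝ, y - a • v + r • v = y + (r - a) • v := fun r => by module
  simp_rw [e]
  field_simp

/-- The X-ray transform along the line joining a detector pair. -/
lemma Admissible.xray_formula (hS : S.Admissible D) {y v x x' : R3} (hv : ‖v‖ = 1)
    (hp : IsDetectorPair D S y v x x') (hy : S.f y ≠ 0) :
    xray (fun z => S.ε * S.α₁ z) y v =
      8 * Real.pi * (S.M0 x y * ‖y - x‖ + S.M0 x' y * ‖y - x'‖) / S.f y := by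
  obtain ⟨hx, hx', a, b, ha, hb, rfl, rfl, hseg⟩ := hp
  have h1 := hS.M0_mul_norm hv ha hx hy
  -- Reversing the direction turns the far detector into a near one.
  have e : y + b • v = y - b • (-v) := by module
  have h2 := hS.M0_mul_norm (v := -v) (by rwa [norm_neg]) hb (e ▸ hx') hy
  rw [← e] at h2
  have h3 := intervalIntegral.integral_comp_neg (a := -b) (b := 0)
    (fun s : ℝ => S.ε * S.α₁ (y + s • v))
  simp only [neg_smul, neg_zero, neg_neg] at h3
  simp only [smul_neg] at h2
  rw [h3] at h2
  have hα := hS.contDiff_α₁.continuous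
  have hci : ∀ p q : ℝ, IntervalIntegrable (fun s : ℝ => S.ε * S.α₁ (y + s • v)) volume p q :=
    fun p q => Continuous.intervalIntegrable (by fun_prop) p q
  -- The half-open interval suffices: its missing endpoint is a detector, hence outside the support
  -- of `f`.
  have hsupp : Function.support (fun s : ℝ => S.ε * S.α₁ (y + s • v)) ⊆ Set.Ioc (-a) b := by
    intro s hs
    have hmem : y + s • v ∈ tsupport S.f := by
      by_contra h
      exact hs (by simp [hS.α₁_eq_zero h])
    refine ⟨lt_of_le_of_ne (hseg s hmem).1 ?_, (hseg s hmem).2⟩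
    rintro rfl
    exact hS.notMem_tsupport hx (by simpa [sub_eq_add_neg] using hmem)
  rw [eq_div_iff hy, mul_add, h1, h2, ← add_mul,
    intervalIntegral.integral_add_adjacent_intervals (hci _ _) (hci _ _),
    intervalIntegral.integral_eq_integral_of_support_subset hsupp, xray]

lemma Admissible.Ninf_eq_zero (hS : S.Admissible D) {x y : R3} (hx : x ∈ D) (hy : S.f y = 0) :
    S.Ninf x y = 0 := by
  have hi : S.inverted x y = fun _ => 0 := by
    rw [hS.inverted_eq hx y]; simp [hy]
  have := (dataExist_of (S := S) (x := x) (y := y) (h' := fun _ => 0) (L := 0) (a := 0) (b := 0)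
    (d := 0) (fun t _ => hi ▸ hasDerivAt_const _ _) tendsto_const_nhds (by simp [hi])).2.2
  simpa using this

/-- Near a point of the support of `f` outside of the perturbations, `f` is nonzero at points
outside of the perturbations. -/
lemma mem_closure_inter {p : R3} {U : Set R3} (hp : p ∈ tsupport S.f) (hU : IsOpen U)
    (hpU : p ∈ U) : p ∈ closure ({z | S.f z ≠ 0} ∩ U) := by
  have h : p ∈ U ∩ closure {z | S.f z ≠ 0} := ⟨hpU, hp⟩
  rw [Set.inter_comm]
  exact hU.inter_closure h

lemma isOpen_compl_perturbed (S : Specimen) : IsOpen S.perturbedᶜ :=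
  ((isClosed_tsupport _).union (isClosed_tsupport _)).isOpen_compl

/-- Equality of the two transforms is a closed condition on the base point, so it is enough to prove
it at unperturbed points with `S.f ≠ 0` accumulating at `p`. -/
lemma Admissible.xray_eq_of_data_eq (hD : IsCompact D) (hS : S.Admissible D)
    (hS' : S'.Admissible D) (h0 : ∀ x ∈ D, ∀ y : R3, S'.M0 x y = S.M0 x y)
    (hN : ∀ x ∈ D, ∀ y : R3, S'.Ninf x y = S.Ninf x y) {p v : R3} (hv : ‖v‖ = 1)
    (hp : p ∈ tsupport S.f) (hpS : p ∉ S.perturbed) (hpS' : p ∉ S'.perturbed) :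
    xray (fun z => S'.ε * S'.α₁ z) p v = xray (fun z => S.ε * S.α₁ z) p v := by
  have hcl := isClosed_eq (hS'.continuous_xray hv) (hS.continuous_xray hv)
  refine closure_minimal ?_ hcl (mem_closure_inter hp
    ((isOpen_compl_perturbed S).inter (isOpen_compl_perturbed S')) ⟨hpS, hpS'⟩)
  rintro y ⟨hy, hyS, hyS'⟩
  obtain ⟨x, x', hpair, hpair'⟩ := exists_common_detectorPair hD hS hS' (subset_tsupport _ hy) hv
  have hf : S.f y = 4 * Real.pi * S.Ninf x y := hS.Ninf_eq hpair.1 hy hyS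
  -- A zero of `S'.f` would force zero data `Ninf`, while the common `Ninf` recovers `S.f y ≠ 0`.
  have hy' : S'.f y ≠ 0 := by
    intro h
    have := hS'.Ninf_eq_zero hpair.1 h
    rw [hN x hpair.1] at this
    rw [this, mul_zero] at hf
    exact hy hf
  have hf' : S'.f y = 4 * Real.pi * S'.Ninf x y := hS'.Ninf_eq hpair.1 hy' hyS'
  rw [hN x hpair.1, ← hf] at hf'
  change xray _ y v = xray _ y v
  rw [hS'.xray_formula hv hpair' hy', hS.xray_formula hv hpair hy, hf', h0 x hpair.1,
    h0 x' hpair.2.1]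

/-- The last point of the line in the union of the supports is interior to neither, so it is
unperturbed for both specimens. It lies in at least one support, and the situation is symmetric. -/
lemma Admissible.xray_determined (hD : IsCompact D) (hS : S.Admissible D)
    (hS' : S'.Admissible D) (h0 : ∀ x ∈ D, ∀ y : R3, S'.M0 x y = S.M0 x y)
    (hN : ∀ x ∈ D, ∀ y : R3, S'.Ninf x y = S.Ninf x y) {v : R3} (y : R3) (hv : ‖v‖ = 1) :
    xray (fun z => S'.ε * S'.α₁ z) y v = xray (fun z => S.ε * S.α₁ z) y v := by
  by_cases h : ∃ s : ℝ, y + s • v ∈ tsupport S.f ∪ tsupport S'.f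
  · obtain ⟨s, hs, hsi⟩ := exists_last_point
      (hS.hasCompactSupport_f.isCompact.union hS'.hasCompactSupport_f.isCompact) hv h
    have hpS : y + s • v ∉ S.perturbed := fun h =>
      hsi (interior_mono Set.subset_union_left (hS.perturbed_ssubset.subset h))
    have hpS' : y + s • v ∉ S'.perturbed := fun h =>
      hsi (interior_mono Set.subset_union_right (hS'.perturbed_ssubset.subset h))
    rw [← xray_add_smul _ y v s, ← xray_add_smul (fun z => S.ε * S.α₁ z) y v s]
    rcases hs with hs | hs
    · exact hS.xray_eq_of_data_eq hD hS' h0 hN hv hs hpS hpS'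
    · exact (hS'.xray_eq_of_data_eq hD hS (fun x hx y => (h0 x hx y).symm)
        (fun x hx y => (hN x hx y).symm) hv hs hpS' hpS).symm
  · push Not at h
    rw [hS.xray_eq_zero fun s hs => h s (Or.inl hs), hS'.xray_eq_zero fun s hs => h s (Or.inr hs)]

/-- At points `y₀` near the last point of the line in the support the formula is exact for the
parallel line through `y₀`; the error is only the variation of the X-ray transform with its base
point. -/
lemma Admissible.exists_approximation (hD : IsCompact D) (hS : S.Admissible D) {y v : R3}
    (hv : ‖v‖ = 1) (h : ∃ s : ℝ, y + s • v ∈ tsupport S.f) {δ : ℝ} (hδ : 0 < δ) :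
    ∃ (s : ℝ) (y₀ x x' : R3), dist y₀ (y + s • v) < δ ∧
      IsDetectorPair D S y₀ v x x' ∧ y₀ ∉ S.perturbed ∧ S.f y₀ ≠ 0 ∧
      |xray (fun z => S.ε * S.α₁ z) y v -
        8 * Real.pi * (S.M0 x y₀ * ‖y₀ - x‖ + S.M0 x' y₀ * ‖y₀ - x'‖) /
          (4 * Real.pi * S.Ninf x y₀)| < δ := by
  obtain ⟨s, hs, hsi⟩ := exists_last_point hS.hasCompactSupport_f.isCompact hv h
  have hcl := mem_closure_inter hs (isOpen_compl_perturbed S)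
    fun h => hsi (hS.perturbed_ssubset.subset h)
  have hev := ((hS.continuous_xray hv).continuousAt (x := y + s • v)).eventually_mem
    (Metric.ball_mem_nhds _ hδ)
  obtain ⟨y₀, ⟨hy₀, hd⟩, hf, hP⟩ :=
    (mem_closure_iff_nhds.1 hcl) _ (hev.and (Metric.ball_mem_nhds _ hδ))
  obtain ⟨x, x', hpair, -⟩ := exists_common_detectorPair hD hS hS (subset_tsupport _ hf) hv
  refine ⟨s, y₀, x, x', hd, hpair, hP, hf, ?_⟩
  rw [← hS.Ninf_eq hpair.1 hf hP, ← hS.xray_formula hv hpair hf, ← xray_add_smul _ y v s, abs_sub_comm]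
  exact hy₀

end Specimen
end

theorem mainTheorem5 (D : Set R3) (hD : IsCompact D) (S : Specimen) (hS : S.Admissible D) :
    -- the data are well defined
    (∀ x ∈ D, ∀ y : R3, S.DataExist x y) ∧
    -- the data determine the X-ray transform along all lines
    (∀ S' : Specimen, S'.Admissible D →
      (∀ x ∈ D, ∀ y : R3, S'.M0 x y = S.M0 x y) →
      (∀ x ∈ D, ∀ y : R3, S'.Ninf x y = S.Ninf x y) →
      ∀ y v : R3, ‖v‖ = 1 →
        xray (fun z => S'.ε * S'.α₁ z) y v = xray (fun z => S.ε * S.α₁ z) y v) ∧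
    -- detector pairs exist on every line through a point of the support of `f`
    (∀ y ∈ tsupport S.f, ∀ v : R3, ‖v‖ = 1 → ∃ x x' : R3, IsDetectorPair D S y v x x') ∧
    -- the explicit formula from two detector points
    (∀ (y v : R3) (s : ℝ) (y₀ x x' : R3), ‖v‖ = 1 → y₀ = y + s • v →
      IsDetectorPair D S y₀ v x x' → y₀ ∉ S.perturbed → S.f y₀ ≠ 0 →
        S.f y₀ = 4 * Real.pi * S.Ninf x y₀ ∧
        xray (fun z => S.ε * S.α₁ z) y v =
          8 * Real.pi * (S.M0 x y₀ * ‖y₀ - x‖ + S.M0 x' y₀ * ‖y₀ - x'‖) / S.f y₀) ∧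
    -- on the remaining lines the transform vanishes or is a limit of values of the formula
    (∀ y v : R3, ‖v‖ = 1 → (∀ s : ℝ, y + s • v ∉ tsupport S.f) →
      xray (fun z => S.ε * S.α₁ z) y v = 0) ∧
    (∀ y v : R3, ‖v‖ = 1 → (∃ s : ℝ, y + s • v ∈ tsupport S.f) →
      ∀ δ > 0, ∃ (s : ℝ) (y₀ x x' : R3), dist y₀ (y + s • v) < δ ∧
        IsDetectorPair D S y₀ v x x' ∧ y₀ ∉ S.perturbed ∧ S.f y₀ ≠ 0 ∧
        |xray (fun z => S.ε * S.α₁ z) y v -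
          8 * Real.pi * (S.M0 x y₀ * ‖y₀ - x‖ + S.M0 x' y₀ * ‖y₀ - x'‖) /
            (4 * Real.pi * S.Ninf x y₀)| < δ) := by
  refine ⟨fun x hx y => hS.dataExist hx y, fun S' hS' h0 hN y v hv =>
    hS.xray_determined hD hS' h0 hN y hv, fun y hy v hv => ?_, ?_,
    fun y v _ h => hS.xray_eq_zero h, fun y v hv h δ hδ => hS.exists_approximation hD hv h hδ⟩
  · obtain ⟨x, x', h, -⟩ := exists_common_detectorPair hD hS hS hy hv
    exact ⟨x, x', h⟩
  · rintro y v s y₀ x x' hv rfl hp hP hf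
    refine ⟨hS.Ninf_eq hp.1 hf hP, ?_⟩
    rw [← hS.xray_formula hv hp hf, xray_add_smul]
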